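/- Let $\mathsf k$ be an infinite field, let $d,k\ge 1$ be integers, put $j=2d+k-3$, and assume that $\mathrm{char}\,\mathsf k=0$ or $\mathrm{char}\,\mathsf k>j$. Let $$T=(1,2,\dots,d-1,\underbrace{d,\dots,d}_{k},d-1,\dots,2,1),$$ a sequence indexed by the degrees $0,1,\dots,j$ with sum $d(d+k-1)$. A partition $P=(p_1\ge p_2\ge\cdots)$ has diagonal lengths $T$ if for every $i\ge 0$ its Ferrers diagram has exactly $T_i$ boxes (row $r\ge0$, column $c\ge0$) with $r+c=i$. Such a $P$ is a CIJT partition if there are a graded Artinian complete intersection $A=\mathsf k[x,y]/I$ (that is, $I$ is generated by a regular sequence of two homogeneous polynomials) of Hilbert function $T$ and a linear form $\ell$ such that $P$ is the Jordan type of $(A,\ell)$, i.e. its parts are the sizes of the Jordan blocks of multiplication by $\ell$ on $A$. For a partition $P$ with smallest part $s$ of multiplicity $m$, let $\iota(P)$ be the partition obtained from $P$ by conjugating the block of smallest parts, i.e. replacing $s^m$ by $m^s$. CIJT partitions below always have diagonal lengths $T$. (a) If $P$ is a CIJT partition with $d$ parts, then its block of smallest parts is $(a+k)^{a+1}$ for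 some $a\in[0,d-1]$. The map $P\mapsto\iota(P)$ is a bijection from the set of CIJT partitions with $d$ parts onto the set of CIJT partitions with $d+k-1$ parts. Suppose moreover that $k\ge 2$ and $\mathrm{char}\,\mathsf k=0$. Let $\mathsf k[x,y]$ act on $\mathsf k[X,Y]$ by differentiation. For a form $F\in\mathsf k[X,Y]$ of degree $j$ for which $A=\mathsf k[x,y]/\mathrm{Ann}(F)$ is a complete intersection of Hilbert function $T$, for $0\le i\le d-1$, and for $\ell=ax+by$, let $h^i_\ell(F)$ be the value at $(X,Y)=(a,b)$ of the Hessian determinant $\det\big[(\alpha_u\alpha_v)\circ F\big]_{0\le u,v\le i}$, where $\alpha_u=x^{i-u}y^u$. For a CIJT partition $Q$, the set $\mathcal H_Q=\{i\in[0,d-1] : h^i_\ell(F)=0\}$ is the same for all pairs $(F,\ell)$ such that $(\mathsf k[x,y]/\mathrm{Ann}(F),\ell)$ has Hilbert function $T$ and Jordan type $Q$, and such pairs exist, both for $Q=P$ a CIJT partition with $d$ parts and for $Q=\iota(P)$; and $$d-1\notin\mathcal H_P,\qquad \mathcal H_{\iota(P)}=\mathcal H_P\cup\{d-1\}.$$ (b)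 There are exactly $2^{d-1}$ CIJT partitions with $d$ parts, and exactly $2^{d-1}$ CIJT partitions with $d+k-1$ parts. (c) Let $d\ge2$. For $0\le a\le d-2$ there are exactly $2^{d-2-a}$ CIJT partitions with $d$ parts and smallest part $a+k$. There is exactly one CIJT partition with $d$ parts and smallest part $d+k-1$, and in it this part has multiplicity $d$. (d) Let $P=(p_1\ge\cdots\ge p_t)$ be a CIJT partition with $t=d$ or $t=d+k-1$ parts, and let $A$ be any graded complete intersection quotient of $\mathsf k[x,y]$ of Hilbert function $T$ and $\ell$ any linear form such that $(A,\ell)$ has Jordan type $P$. Then $A$ is a direct sum of strings $\langle z,\ell z,\dots,\ell^{s-1}z\rangle$ (with $\ell^sz=0$) with homogeneous generators $z$, and in every such decomposition the $i$-th string, of length $p_i$, begins in degree $i-1$: if $V_{i,s}$ denotes the span of the generators of degree $i$ of the strings of length $s$, then $\dim_{\mathsf k}V_{i-1,p_i}=1$ for $1\le i\le t$, and $V_{i,s}=0$ unless $0\le i<t$ and $s=p_{i+1}$. -/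

import Mathlib

open MvPolynomial

namespace CIJT

/-! ### Partitions -/

/-- The `i`-th largest part of a partition, counted from `i = 0`; it is `0` beyond the last part. -/
def part {n : ℕ} (P : n.Partition) (i : ℕ) : ℕ :=
  (P.parts.sort (· ≥ ·)).getD i 0

/-- The number of boxes of the Ferrers diagram of `P` on its `i`-th diagonal of slope one,
i.e. the number of rows `r ≤ i` that have a box in column `i - r` (rows and columns are counted
from `0`). -/
def diagLength {n : ℕ} (P : n.Partition) (i : ℕ) : ℕ :=
  ((Finset.range (i + 1)).filter fun r => i - r < part P r).card

/-- The smallest part of a partition (of a positive integer). -/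
noncomputable def smallestPart {n : ℕ} (P : n.Partition) : ℕ :=
  sInf {m | m ∈ P.parts}

theorem smallestPart_mem {n : ℕ} (P : n.Partition) (h : smallestPart P ≠ 0) :
    smallestPart P ∈ P.parts := by
  have hne : {m | m ∈ P.parts}.Nonempty := by
    by_contra hc
    rw [Set.not_nonempty_iff_eq_empty] at hc
    exact h (by simp [smallestPart, hc])
  exact Nat.sInf_mem hne

/-- Conjugate the rectangle `s ^ m` formed by the smallest part `s`, of multiplicity `m`:
the rectangle `s ^ m` is replaced by `m ^ s`, and all other parts are kept. -/
noncomputable def iota {n : ℕ} (P : n.Partition) : n.Partition where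
  parts := P.parts.filter (fun x => x ≠ smallestPart P) +
    Multiset.replicate (smallestPart P) (P.parts.count (smallestPart P))
  parts_pos := by
    intro i hi
    rcases Multiset.mem_add.1 hi with h | h
    · exact P.parts_pos (Multiset.mem_filter.1 h).1
    · obtain ⟨h0, rfl⟩ := Multiset.mem_replicate.1 h
      exact Multiset.count_pos.2 (smallestPart_mem P h0)
  parts_sum := by
    have h := congrArg Multiset.sum
      (Multiset.filter_add_not (fun x => x = smallestPart P) P.parts)
    rw [Multiset.sum_add, Multiset.filter_eq', Multiset.sum_replicate, P.parts_sum] at h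
    rw [Multiset.sum_add, Multiset.sum_replicate, smul_eq_mul, mul_comm, add_comm]
    simpa using h

/-- The sequence `T(d,k) = (1, 2, …, d-1, d, …, d, d-1, …, 2, 1)` in which the height `d` occurs
`k` times (`d` and `k` positive), extended by zero: its entry in degree `i` is `i + 1` for
`i < d`, it is `d` for `d - 1 ≤ i ≤ d + k - 2`, and it is `2d + k - 2 - i` from there on. -/
def T (d k i : ℕ) : ℕ :=
  min (min (i + 1) d) (2 * d + k - 2 - i)

/-! ### Graded quotients of `K[x,y]` -/

section Algebra

variable {K : Type*} [Field K]

/-- `I` is generated by a regular sequence of two homogeneous polynomials of `K[x,y]`, i.e.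
`K[x,y]/I` is a graded Artinian complete intersection. -/
def IsGradedCI (I : Ideal (MvPolynomial (Fin 2) K)) : Prop :=
  ∃ (f g : MvPolynomial (Fin 2) K) (m n : ℕ), f.IsHomogeneous m ∧ g.IsHomogeneous n ∧
    RingTheory.Sequence.IsRegular (MvPolynomial (Fin 2) K) [f, g] ∧ I = Ideal.span {f, g}

/-- The degree `i` component of `K[x,y]/I`. -/
noncomputable def gradedPiece (I : Ideal (MvPolynomial (Fin 2) K)) (i : ℕ) :
    Submodule K (MvPolynomial (Fin 2) K ⧸ I) :=
  (homogeneousSubmodule (Fin 2) K i).map (Ideal.Quotient.mkₐ K I).toLinearMap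

/-- The Hilbert function of `K[x,y]/I`. -/
noncomputable def hilbertFunction (I : Ideal (MvPolynomial (Fin 2) K)) (i : ℕ) : ℕ :=
  Module.finrank K (gradedPiece I i)

/-- Multiplication by (the class of) `ℓ` on `K[x,y]/I`. -/
noncomputable def mulMap (I : Ideal (MvPolynomial (Fin 2) K)) (ℓ : MvPolynomial (Fin 2) K) :
    Module.End K (MvPolynomial (Fin 2) K ⧸ I) :=
  LinearMap.mulLeft K (Ideal.Quotient.mk I ℓ)

/-- The endomorphism `φ` is nilpotent and the sizes of its Jordan blocks are the parts of `P`: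
there is a basis made of strings `b, φ b, …, φ ^ (p - 1) b` with `φ ^ p b = 0`, one string for
each part `p` of `P`. -/
def HasJordanType {V : Type*} [AddCommGroup V] [Module K V] (φ : Module.End K V)
    {n : ℕ} (P : n.Partition) : Prop :=
  ∃ b : Module.Basis (Σ i : Fin P.parts.card, Fin (part P i)) K V,
    ∀ (i : Fin P.parts.card) (s : Fin (part P i)),
      φ (b ⟨i, s⟩) = if h : (s : ℕ) + 1 < part P i then b ⟨i, ⟨s + 1, h⟩⟩ else 0

/-- `K[x,y]/I` is a graded complete intersection of Hilbert function `T(d,k)`, `ℓ` is a linear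
form, and `P` is the Jordan type of multiplication by `ℓ` on `K[x,y]/I`. -/
def Realizes (d k : ℕ) {n : ℕ} (P : n.Partition) (I : Ideal (MvPolynomial (Fin 2) K))
    (ℓ : MvPolynomial (Fin 2) K) : Prop :=
  IsGradedCI I ∧ (∀ i, hilbertFunction I i = T d k i) ∧ ℓ.IsHomogeneous 1 ∧
    HasJordanType (mulMap I ℓ) P

variable (K) in
/-- `P` is a complete intersection Jordan type (over `K`) of diagonal lengths `T(d,k)`. -/
def IsCIJT (d k : ℕ) {n : ℕ} (P : n.Partition) : Prop :=
  (∀ i, diagLength P i = T d k i) ∧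
    ∃ (I : Ideal (MvPolynomial (Fin 2) K)) (ℓ : MvPolynomial (Fin 2) K), Realizes d k P I ℓ

/-- A decomposition of `K[x,y]/I` into strings `z, ℓ z, …, ℓ ^ (s - 1) z`, where `ℓ ^ s z = 0`,
with homogeneous generators `z`. -/
structure StringDecomposition (I : Ideal (MvPolynomial (Fin 2) K))
    (ℓ : MvPolynomial (Fin 2) K) where
  /-- the number of strings -/
  num : ℕ
  /-- the degrees of the generators -/
  deg : Fin num → ℕ
  /-- the lengths of the strings -/
  len : Fin num → ℕ
  /-- the generators of the strings -/
  gen : Fin num → MvPolynomial (Fin 2) K ⧸ I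
  len_pos : ∀ u, 0 < len u
  gen_mem : ∀ u, gen u ∈ gradedPiece I (deg u)
  pow_len : ∀ u, ((mulMap I ℓ) ^ len u) (gen u) = 0
  linearIndependent : LinearIndependent K
    fun v : (Σ u : Fin num, Fin (len u)) => ((mulMap I ℓ) ^ (v.2 : ℕ)) (gen v.1)
  span_eq_top : Submodule.span K
    (Set.range fun v : (Σ u : Fin num, Fin (len u)) =>
      ((mulMap I ℓ) ^ (v.2 : ℕ)) (gen v.1)) = ⊤

/-- The space `V_{i,s}` spanned by the generators of degree `i` of the strings of length `s`. -/
noncomputable def StringDecomposition.V {I : Ideal (MvPolynomial (Fin 2) K)} {ℓ : MvPolynomial (Fin 2) K}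
    (D : StringDecomposition I ℓ) (i s : ℕ) : Submodule K (MvPolynomial (Fin 2) K ⧸ I) :=
  Submodule.span K {z | ∃ u, D.deg u = i ∧ D.len u = s ∧ D.gen u = z}

/-! ### Macaulay dual generators and Hessians -/

/-- The action of `K[x,y]` on `K[X,Y]` by differentiation, `x` acting as `∂/∂X` and `y` as
`∂/∂Y`. -/
noncomputable def diffAct (r F : MvPolynomial (Fin 2) K) : MvPolynomial (Fin 2) K :=
  ∑ m ∈ r.support, r.coeff m •
    ((pderiv (R := K) (0 : Fin 2))^[m 0] ((pderiv (R := K) (1 : Fin 2))^[m 1] F))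

/-- `F` is a form of degree `j` whose annihilator under the action by differentiation is `I`. -/
def IsDualGenerator (I : Ideal (MvPolynomial (Fin 2) K)) (j : ℕ)
    (F : MvPolynomial (Fin 2) K) : Prop :=
  F.IsHomogeneous j ∧ ∀ r, r ∈ I ↔ diffAct r F = 0

/-- The monomial basis `x ^ i, x ^ (i-1) y, …, y ^ i` of the forms of degree `i`. -/
noncomputable def monomialBasis (K : Type*) [Field K] (i : ℕ) (u : Fin (i + 1)) :
    MvPolynomial (Fin 2) K :=
  X 0 ^ (i - (u : ℕ)) * X 1 ^ (u : ℕ)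

/-- The `i`-th Hessian matrix of `F` with respect to the monomial basis in degree `i`. It is used
for the degrees `i < d` only, where `I = Ann F` has no nonzero element of degree `i`, so that
these monomials are a basis of the degree `i` component of `K[x,y]/I`. -/
noncomputable def hessianMatrix (i : ℕ) (F : MvPolynomial (Fin 2) K) :
    Matrix (Fin (i + 1)) (Fin (i + 1)) (MvPolynomial (Fin 2) K) :=
  Matrix.of fun u v => diffAct (monomialBasis K i u * monomialBasis K i v) F

/-- The value of the `i`-th Hessian determinant of `F` at the point `(a, b)` of the linear form
`ℓ = a x + b y`. -/
noncomputable def hessianAt (i : ℕ) (F ℓ : MvPolynomial (Fin 2) K) : K :=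
  MvPolynomial.eval (fun s => ℓ.coeff (Finsupp.single s 1)) (hessianMatrix i F).det

/-- The degrees `i ≤ d - 1` of the Hessians of `F` that vanish at `ℓ`. -/
def vanishingHessians (d : ℕ) (F ℓ : MvPolynomial (Fin 2) K) : Set ℕ :=
  {i | i < d ∧ hessianAt i F ℓ = 0}

variable (K) in
/-- The sets of vanishing Hessians, among `h^0, …, h^(d-1)`, of all realizations of `P` as the
Jordan type of a linear form `ℓ` on a complete intersection `K[x,y]/Ann F` of Hilbert function
`T(d,k)`, whose socle degree is `2d + k - 3`. -/
def hessianSets (d k : ℕ) {n : ℕ} (P : n.Partition) : Set (Set ℕ) :=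
  {S | ∃ (I : Ideal (MvPolynomial (Fin 2) K)) (F ℓ : MvPolynomial (Fin 2) K),
    Realizes d k P I ℓ ∧ IsDualGenerator I (2 * d + k - 3) F ∧ vanishingHessians d F ℓ = S}

end Algebra

variable (K : Type*) [Field K] in
/-- The CIJT partitions of diagonal lengths `T(d,k)` having exactly `m` parts. They are partitions
of `d (d + k - 1)`, the sum of the entries of `T(d,k)`. -/
def cijtWithParts (d k m : ℕ) : Set (d * (d + k - 1)).Partition :=
  {P | IsCIJT K d k P ∧ P.parts.card = m}

end CIJT

/-! Let `t` and `t'` be the numbers `d` and `d + k - 1` in either order, and let `p i` be the rows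
of a partition with `t` parts. Counting the rows that reach beyond a given diagonal shows that the
diagonal lengths are `T` exactly when the numbers `i + p i`, for `i < t`, run once through `[t', t +
t')` (`shape_iff`). The row `m` with `i + p i` equal to `t'` then opens a final block of `t - m`
rows of length `t' - m`, and the rows above it form an arbitrary shape for `(m, t + t' - m)`
(`Shape.exists_split`, `Shape.extend`). Since the upper part involves only `m` and `t + t'`,
conjugating the block exchanges `t` and `t'`: this is the bijection `ι`, and recursion on `m` gives
the counts.

Every such partition is realized. Put `z 0 = 1` and `z (i + 1) = y * z i - x ^ (i + 1 - b) * z b`,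
where the row `b ≤ i` satisfies `b + p b = i + p i + 1`; the correction is absent if there is no
such row. The products `x ^ a * z i` with `p i ≤ a` span an ideal (`shapeIdeal_eq`) that is
generated by `z t` and `x ^ p m * z m`, coprime forms of degrees `t` and `t'`. The remaining
products form the Jordan strings of `x` on the quotient.

Conversely, let `x` be a linear form on a graded quotient `A` of the plane, with complement `y`. As
`A / xA` is spanned by powers of `y`, there is at most one string generator in each degree, and the
length of the string beginning in degree `i` is the least `s` with `x ^ (s + 1) ∣ x ^ s * y ^ i`
(`PlaneGrading.strings_unique`). This gives the degrees of the strings.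

For Hessians, put `e = j - 2 * i`. Up to the factor `e!`, the matrix at `ℓ` is the Gram matrix of
`(r, s) ↦ (ℓ ^ e * r * s) ∘ F` on forms of degree `i`, so it is singular exactly when `ℓ ^ e` has a
kernel on `A_i`, that is, when some `u ≤ i` has `u + p u ≤ j - i` (`vanishingHessians_eq`). Passing
to `ι(P)` changes this condition for `i = d - 1` only. -/

namespace CIJT

/-! ### Rows of a multiset of natural numbers -/

/-- The `i`-th largest element of a multiset of natural numbers, `0` beyond the last one. -/
def rows (M : Multiset ℕ) (i : ℕ) : ℕ := (M.sort (· ≥ ·)).getD i 0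

theorem rows_of_lt {M : Multiset ℕ} {i : ℕ} (h : i < M.card) :
    rows M i = (M.sort (· ≥ ·))[i]'(by simpa using h) := by
  simp [rows, h]

theorem rows_of_le {M : Multiset ℕ} {i : ℕ} (h : M.card ≤ i) : rows M i = 0 := by
  simp [rows, h]

theorem rows_mem {M : Multiset ℕ} {i : ℕ} (h : i < M.card) : rows M i ∈ M := by
  rw [rows_of_lt h, ← Multiset.mem_sort (· ≥ ·)]
  exact List.getElem_mem _

theorem rows_antitone (M : Multiset ℕ) : Antitone (rows M) := by
  intro i i' h
  rcases lt_or_ge i' M.card with h1 | h1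
  · rw [rows_of_lt h1, rows_of_lt (h.trans_lt h1)]
    rcases h.eq_or_lt with rfl | h2
    · exact le_rfl
    · exact List.pairwise_iff_getElem.1 (Multiset.pairwise_sort M (· ≥ ·)) _ _ _ _ h2
  · rw [rows_of_le h1]
    exact Nat.zero_le _

theorem map_rows (M : Multiset ℕ) : (Multiset.range M.card).map (rows M) = M := by
  conv_rhs => rw [← Multiset.sort_eq M (· ≥ ·)]
  rw [← Multiset.coe_range, Multiset.map_coe]
  congr 1
  apply List.ext_getElem
  · simp
  · intro i h1 h2
    rw [List.getElem_map, List.getElem_range, rows_of_lt]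
    simpa using h1

theorem sort_map_range {p : ℕ → ℕ} {t : ℕ} (hp : ∀ i i', i ≤ i' → i' < t → p i' ≤ p i) :
    ((Multiset.range t).map p).sort (· ≥ ·) = (List.range t).map p := by
  apply List.Perm.eq_of_pairwise' (r := (· ≥ ·))
  · exact Multiset.pairwise_sort _ _
  · rw [List.pairwise_map]
    refine List.Pairwise.imp_of_mem (R := (· < ·)) ?_ List.pairwise_lt_range
    intro a b _ hb hab
    exact hp a b hab.le (List.mem_range.1 hb)
  · rw [← Multiset.coe_eq_coe, Multiset.sort_eq, ← Multiset.coe_range, Multiset.map_coe]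

theorem rows_map_range {p : ℕ → ℕ} {t : ℕ} (hp : ∀ i i', i ≤ i' → i' < t → p i' ≤ p i) (i : ℕ) :
    rows ((Multiset.range t).map p) i = if i < t then p i else 0 := by
  rw [rows, sort_map_range hp]
  split_ifs with h <;> simp [h]

/-! ### Shapes -/

/-- `p` is the sequence of rows of a partition with `t` parts such that the diagonals
`i + p i` of the first boxes behind the rows are the numbers of the interval `[t', t + t')`. -/
structure Shape (t t' : ℕ) (p : ℕ → ℕ) : Prop where
  anti : Antitone p
  pos : ∀ i < t, 0 < p i
  zero : ∀ i, t ≤ i → p i = 0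
  inj : ∀ i < t, ∀ i' < t, i + p i = i' + p i' → i = i'
  lb : ∀ i < t, t' ≤ i + p i
  ub : ∀ i < t, i + p i < t + t'

namespace Shape

variable {t t' : ℕ} {p : ℕ → ℕ}

theorem image_eq (h : Shape t t' p) :
    (Finset.range t).image (fun i => i + p i) = Finset.Ico t' (t + t') := by
  apply Finset.eq_of_subset_of_card_le
  · intro v hv
    obtain ⟨i, hi, rfl⟩ := Finset.mem_image.1 hv
    rw [Finset.mem_range] at hi
    exact Finset.mem_Ico.2 ⟨h.lb i hi, h.ub i hi⟩
  · rw [Finset.card_image_of_injOn]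
    · simp
    · intro i hi i' hi' e
      exact h.inj i (by simpa using hi) i' (by simpa using hi') e

theorem exists_index (h : Shape t t' p) {v : ℕ} (h1 : t' ≤ v) (h2 : v < t + t') :
    ∃ i < t, i + p i = v := by
  have : v ∈ (Finset.range t).image (fun i => i + p i) := by
    rw [h.image_eq]; exact Finset.mem_Ico.2 ⟨h1, h2⟩
  simpa using this

/-- From a row to the next, `w + p w` rises by at most one. If row `i + 1` takes neither the value
`i + p i` nor the next one, the sequence has dropped below `i + p i` and cannot climb back without
repeating that value. Hence the row that stops one diagonal later is the next row or lies above. -/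
theorem le_succ_of_eq_succ (h : Shape t t' p) {i b : ℕ} (hi : i < t) (hb : b < t)
    (e : b + p b = i + p i + 1) : b ≤ i + 1 := by
  by_contra hc
  push Not at hc
  have key : ∀ w, i + 1 ≤ w → w ≤ b → w + p w < i + p i := by
    intro w hw
    induction w, hw using Nat.le_induction with
    | base =>
      intro _
      have h1 := h.anti (Nat.le_succ i)
      have h2 := fun e => h.inj (i + 1) (by omega) i hi e
      have h3 := fun e => h.inj (i + 1) (by omega) b hb e
      simp only [Nat.succ_eq_add_one] at h1
      by_contra h4
      rcases (by omega : i + 1 + p (i + 1) = i + p i ∨ i + 1 + p (i + 1) = i + p i + 1)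
        with h5 | h5
      · have := h2 h5; omega
      · have := h3 (by omega); omega
    | succ w hw ih =>
      intro hwb
      have h0 := ih (by omega)
      have h1 := h.anti (Nat.le_succ w)
      have h2 := fun e => h.inj (w + 1) (by omega) i hi e
      simp only [Nat.succ_eq_add_one] at h1
      by_contra h4
      have := h2 (by omega)
      omega
  have := key b (by omega) le_rfl
  omega

/-- The row `m` is the one on the lowest diagonal `t'`. The later rows are no longer than `t' - m`,
and a shorter one would share its diagonal with an earlier row of the block. The block fills `[t', t
+ t' - m)`, which leaves `[t + t' - m, t + t')` for the `m` rows above. -/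
theorem exists_split (h : Shape t t' p) (ht : 0 < t) :
    ∃ m, m < t ∧ m < t' ∧ (∀ i, m ≤ i → i < t → p i = t' - m) ∧
      Shape m (t + t' - m) (fun i => if i < m then p i else 0) := by
  obtain ⟨m, hm, e⟩ := h.exists_index le_rfl (by omega : t' < t + t')
  have hpm := h.pos m hm
  have key : ∀ i, m ≤ i → i < t → p i = t' - m := by
    intro i hi
    induction i using Nat.strong_induction_on with
    | _ i ih =>
      intro hit
      rcases Nat.eq_zero_or_pos (i - m) with h0 | h0
      · have : i = m := by omega
        subst this; omega
      · have h1 := ih (i - 1) (by omega) (by omega) (by omega)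
        have h2 : p i ≤ p (i - 1) := h.anti (by omega)
        have h3 := h.lb i hit
        by_contra h4
        -- If row `i` were too short, this earlier row of the block would lie on the same diagonal.
        have h5 := ih (i + p i - (t' - m)) (by omega) (by omega) (by omega)
        have := h.inj (i + p i - (t' - m)) (by omega) i hit (by omega)
        omega
  refine ⟨m, hm, by omega, key, ?_⟩
  refine ⟨?_, ?_, ?_, ?_, ?_, ?_⟩
  · intro i i' hi
    have := h.anti hi
    dsimp only
    split_ifs <;> omega
  · intro i hi
    simp only [hi, if_true]
    exact h.pos i (by omega)
  · intro i hi
    simp only [not_lt.2 hi, if_false]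
  · intro i hi i' hi'
    simp only [hi, hi', if_true]
    exact h.inj i (by omega) i' (by omega)
  · intro i hi
    simp only [hi, if_true]
    have h1 := h.lb i (by omega)
    by_contra hc
    -- A row above the block on a diagonal below `t + t' - m` would collide with this row of the
    -- block.
    have h3 := key (i + p i - (t' - m)) (by omega) (by omega)
    have := h.inj (i + p i - (t' - m)) (by omega) i (by omega) (by omega)
    omega
  · intro i hi
    simp only [hi, if_true]
    have := h.ub i (by omega)
    omega

theorem lt_of_lt {m s : ℕ} {q : ℕ → ℕ} (h : Shape m s q) (e : m + s = t + t') (hm : m < t)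
    {i : ℕ} (hi : i < m) : t' - m < q i := by
  have := h.lb i hi
  have := h.pos i hi
  omega

theorem extend {m s : ℕ} {q : ℕ → ℕ} (h : Shape m s q) (e : m + s = t + t') (hm : m < t)
    (hm' : m < t') :
    Shape t t' (fun i => if i < m then q i else if i < t then t' - m else 0) := by
  have key := fun i hi => h.lt_of_lt e hm (i := i) hi
  refine ⟨?_, ?_, ?_, ?_, ?_, ?_⟩
  · intro i i' hi
    have := h.anti hi
    have := key i
    beta_reduce
    split_ifs <;> omega
  · intro i hi
    have := h.pos i
    split_ifs with h1 <;> omega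
  · intro i hi
    split_ifs <;> omega
  · intro i hi i' hi'
    have h1 := h.inj i
    have h2 := h.lb i
    have h3 := h.lb i'
    split_ifs with h4 h5 h6
    · exact h1 h4 i' h5
    · have := h2 h4; omega
    · have := h3 h6; omega
    · omega
  · intro i hi
    have h2 := h.lb i
    split_ifs with h4
    · have := h2 h4; omega
    · omega
  · intro i hi
    have h2 := h.ub i
    split_ifs with h4
    · have := h2 h4; omega
    · omega

end Shape

/-- The multiset `M` has `t` elements, and its rows form a `Shape t t'`. -/
def IsShape (t t' : ℕ) (M : Multiset ℕ) : Prop := M.card = t ∧ Shape t t' (rows M)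

theorem IsShape.pos {t t' : ℕ} {M : Multiset ℕ} (h : IsShape t t' M) {x : ℕ} (hx : x ∈ M) :
    0 < x := by
  rw [← map_rows M] at hx
  obtain ⟨i, hi, rfl⟩ := Multiset.mem_map.1 hx
  exact h.2.pos i (by rw [← h.1]; exact Multiset.mem_range.1 hi)

theorem map_range_eq_add {p : ℕ → ℕ} {m t c : ℕ} (hm : m ≤ t)
    (hc : ∀ i, m ≤ i → i < t → p i = c) :
    (Multiset.range t).map p = (Multiset.range m).map p + Multiset.replicate (t - m) c := by
  obtain ⟨r, rfl⟩ := Nat.exists_eq_add_of_le hm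
  rw [Multiset.range_add, Multiset.map_add, Multiset.map_map]
  congr 1
  rw [Nat.add_sub_cancel_left, Multiset.eq_replicate]
  refine ⟨by simp, ?_⟩
  intro b hb
  obtain ⟨i, hi, rfl⟩ := Multiset.mem_map.1 hb
  rw [Multiset.mem_range] at hi
  exact hc (m + i) (by omega) (by omega)

theorem IsShape.rows_add_replicate {t t' m s : ℕ} {Q : Multiset ℕ} (h : IsShape m s Q)
    (e : m + s = t + t') (hm : m < t) (hm' : m < t') (i : ℕ) :
    rows (Q + Multiset.replicate (t - m) (t' - m)) i =
      if i < m then rows Q i else if i < t then t' - m else 0 := by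
  set q : ℕ → ℕ := fun i => if i < m then rows Q i else if i < t then t' - m else 0 with hq
  have hs : Shape t t' q := h.2.extend e hm hm'
  have hQ : (Multiset.range m).map q = Q := by
    conv_rhs => rw [← map_rows Q, h.1]
    refine Multiset.map_congr rfl ?_
    intro i hi
    simp [hq, Multiset.mem_range.1 hi]
  have h1 : Q + Multiset.replicate (t - m) (t' - m) = (Multiset.range t).map q := by
    rw [map_range_eq_add hm.le (c := t' - m), hQ]
    intro i hi hi'
    simp [hq, not_lt.2 hi, hi']
  rw [h1, rows_map_range (fun i i' hi _ => hs.anti hi)]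
  rw [← show q i = if i < m then rows Q i else if i < t then t' - m else 0 from rfl]
  split_ifs with h2
  · rfl
  · exact (hs.zero i (by omega)).symm

theorem IsShape.add_replicate {t t' m s : ℕ} {Q : Multiset ℕ} (h : IsShape m s Q)
    (e : m + s = t + t') (hm : m < t) (hm' : m < t') :
    IsShape t t' (Q + Multiset.replicate (t - m) (t' - m)) := by
  refine ⟨by simp [h.1, hm.le], ?_⟩
  have : rows (Q + Multiset.replicate (t - m) (t' - m)) =
      fun i => if i < m then rows Q i else if i < t then t' - m else 0 :=
    funext (h.rows_add_replicate e hm hm')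
  rw [this]
  exact h.2.extend e hm hm'

theorem IsShape.exists_eq_add {t t' : ℕ} {M : Multiset ℕ} (h : IsShape t t' M) (ht : 0 < t) :
    ∃ m Q, m < t ∧ m < t' ∧ IsShape m (t + t' - m) Q ∧
      M = Q + Multiset.replicate (t - m) (t' - m) := by
  obtain ⟨m, hm, hm', hc, hs⟩ := h.2.exists_split ht
  refine ⟨m, (Multiset.range m).map (rows M), hm, hm', ⟨by simp, ?_⟩, ?_⟩
  · convert hs using 1
    funext i
    rw [rows_map_range (fun i i' hi _ => rows_antitone M hi)]
  · conv_lhs => rw [← map_rows M, h.1]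
    exact map_range_eq_add hm.le hc

theorem IsShape.lt_of_mem {t t' m s : ℕ} {Q : Multiset ℕ} (h : IsShape m s Q)
    (e : m + s = t + t') (hm : m < t) {x : ℕ} (hx : x ∈ Q) : t' - m < x := by
  rw [← map_rows Q] at hx
  obtain ⟨i, hi, rfl⟩ := Multiset.mem_map.1 hx
  exact h.2.lt_of_lt e hm (by rw [← h.1]; exact Multiset.mem_range.1 hi)

/-- Splitting off the block reduces this to `m (t + t' - m) + (t - m) (t' - m) = t t'`. -/
theorem IsShape.sum_eq {t t' : ℕ} {M : Multiset ℕ} (h : IsShape t t' M) : M.sum = t * t' := by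
  induction t using Nat.strong_induction_on generalizing t' M with
  | _ t ih =>
    rcases Nat.eq_zero_or_pos t with rfl | ht
    · rw [Multiset.card_eq_zero.1 h.1]; simp
    obtain ⟨m, Q, hm, hm', hQ, rfl⟩ := h.exists_eq_add ht
    rw [Multiset.sum_add, ih m hm hQ, Multiset.sum_replicate, smul_eq_mul]
    obtain ⟨a, rfl⟩ := Nat.exists_eq_add_of_le hm.le
    obtain ⟨b, rfl⟩ := Nat.exists_eq_add_of_le hm'.le
    rw [show m + a + (m + b) - m = m + a + b by omega, Nat.add_sub_cancel_left,
      Nat.add_sub_cancel_left]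
    ring

/-- Subtraction is truncated, so the term `m = 0` equals one and the sum is `1 + 1 + 2 + 4 + ⋯`.
That term counts the empty upper part of a rectangle. -/
theorem sum_two_pow_pred {n : ℕ} (hn : 0 < n) :
    ∑ m ∈ Finset.range n, 2 ^ (m - 1) = 2 ^ (n - 1) := by
  induction n, hn using Nat.le_induction with
  | base => simp
  | succ n hn ih =>
    rw [Finset.sum_range_succ, ih, ← two_mul, ← pow_succ']
    congr 1
    omega

theorem replicate_inj_of_lt {Q Q' : Multiset ℕ} {n n' s s' : ℕ} (hn : 0 < n) (hn' : 0 < n')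
    (hQ : ∀ x ∈ Q, s < x) (hQ' : ∀ x ∈ Q', s' < x)
    (e : Q + Multiset.replicate n s = Q' + Multiset.replicate n' s') : s = s' := by
  have h1 : s ∈ Q' + Multiset.replicate n' s' := by
    rw [← e, Multiset.mem_add, Multiset.mem_replicate]; exact Or.inr ⟨hn.ne', rfl⟩
  have h2 : s' ∈ Q + Multiset.replicate n s := by
    rw [e, Multiset.mem_add, Multiset.mem_replicate]; exact Or.inr ⟨hn'.ne', rfl⟩
  rw [Multiset.mem_add, Multiset.mem_replicate] at h1 h2
  rcases h1 with h1 | h1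
  · rcases h2 with h2 | h2
    · exact absurd (hQ _ h2) (hQ' _ h1).not_gt
    · exact h2.2.symm
  · exact h1.2

/-- A nonempty shape amounts to a choice of `m < min t t'` and a shape for `(m, t + t' - m)`, and
the smaller entry of this pair is `m`. The hypothesis excludes `t > 0`, `t' = 0`, where there is no
shape at all. -/
theorem exists_finset_isShape (t t' : ℕ) (ht : t = 0 ∨ 0 < t') :
    ∃ F : Finset (Multiset ℕ), (∀ M, M ∈ F ↔ IsShape t t' M) ∧ F.card = 2 ^ (min t t' - 1) := by
  classical
  induction t using Nat.strong_induction_on generalizing t' with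
  | _ t ih =>
    rcases Nat.eq_zero_or_pos t with rfl | ht0
    · refine ⟨{0}, ?_, by simp⟩
      intro M
      rw [Finset.mem_singleton]
      constructor
      · rintro rfl
        refine ⟨rfl, rows_antitone _, ?_, fun i _ => by simp [rows], ?_, ?_, ?_⟩ <;>
          intro i hi <;> omega
      · intro h
        exact Multiset.card_eq_zero.1 h.1
    · have ht' : 0 < t' := by omega
      -- The families are made total in `m`, with an arbitrary value out of range, so that `choose`
      -- applies.
      have ih' : ∀ m, ∃ F : Finset (Multiset ℕ), m < min t t' →
          (∀ M, M ∈ F ↔ IsShape m (t + t' - m) M) ∧ F.card = 2 ^ (m - 1) := by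
        intro m
        by_cases hm : m < min t t'
        · obtain ⟨F, hF⟩ := ih m (by omega) (t + t' - m) (by omega)
          refine ⟨F, fun _ => ?_⟩
          rwa [min_eq_left (by omega)] at hF
        · exact ⟨∅, fun h => absurd h hm⟩
      choose F hF using ih'
      refine ⟨(Finset.range (min t t')).biUnion fun m =>
        (F m).image fun Q => Q + Multiset.replicate (t - m) (t' - m), ?_, ?_⟩
      · intro M
        simp only [Finset.mem_biUnion, Finset.mem_range, Finset.mem_image]
        constructor
        · rintro ⟨m, hm, Q, hQ, rfl⟩
          rw [(hF m hm).1] at hQ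
          exact hQ.add_replicate (by omega) (by omega) (by omega)
        · intro h
          obtain ⟨m, Q, hm, hm', hQ, rfl⟩ := h.exists_eq_add ht0
          exact ⟨m, by omega, Q, ((hF m (by omega)).1 Q).2 hQ, rfl⟩
      · rw [Finset.card_biUnion]
        · rw [← sum_two_pow_pred (by omega : 0 < min t t')]
          refine Finset.sum_congr rfl ?_
          intro m hm
          rw [Finset.mem_range] at hm
          rw [Finset.card_image_of_injective _ (add_left_injective _), (hF m hm).2]
        · intro m hm m' hm' hne
          rw [Finset.mem_coe, Finset.mem_range] at hm hm'
          rw [Function.onFun, Finset.disjoint_left]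
          intro M h1 h2
          obtain ⟨Q, hQ, rfl⟩ := Finset.mem_image.1 h1
          obtain ⟨Q', hQ', e⟩ := Finset.mem_image.1 h2
          rw [(hF m hm).1] at hQ
          rw [(hF m' hm').1] at hQ'
          have := replicate_inj_of_lt (by omega) (by omega)
            (fun x hx => hQ.lt_of_mem (t := t) (t' := t') (by omega) (by omega) hx)
            (fun x hx => hQ'.lt_of_mem (t := t) (t' := t') (by omega) (by omega) hx) e.symm
          omega

/-! ### Diagonal lengths -/

/-- A row `i ≤ m` has a box on diagonal `m` exactly when `m < i + p i`. The `t - 1 - m` rows after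
row `m` satisfy this inequality automatically. -/
theorem card_filter_add (t : ℕ) (p : ℕ → ℕ) (hp : ∀ i < t, 0 < p i)
    (h0 : ∀ i, t ≤ i → p i = 0) (m : ℕ) :
    ((Finset.range t).filter fun i => m < i + p i).card =
      ((Finset.range (m + 1)).filter fun r => m - r < p r).card + (t - 1 - m) := by
  have h1 : ((Finset.range t).filter fun i => m < i + p i) =
      ((Finset.range (m + 1)).filter fun r => m - r < p r) ∪ Finset.Ico (m + 1) t := by
    ext i
    have := hp i
    have := h0 i
    simp only [Finset.mem_filter, Finset.mem_range, Finset.mem_union, Finset.mem_Ico]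
    by_cases hi : i < t
    · have := hp i hi
      omega
    · have := h0 i (by omega)
      omega
  rw [h1, Finset.card_union_of_disjoint]
  · rw [Nat.card_Ico]; omega
  · rw [Finset.disjoint_left]
    intro i hi
    simp only [Finset.mem_filter, Finset.mem_range, Finset.mem_Ico] at hi ⊢
    omega

/-- A symmetric form of the sequence `T`: it depends on the degrees of the two generators only. -/
theorem T_eq {d k t t' : ℕ} (hk : 1 ≤ k) (h : t = d ∧ t' = d + k - 1 ∨ t = d + k - 1 ∧ t' = d)
    (i : ℕ) : T d k i = min (min (i + 1) (min t t')) (t + t' - 1 - i) := by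
  unfold T
  omega

/-- The number of rows with `m < i + p i` must be `min t (t + t' - 1 - m)`. Its drop from `v - 1` to
`v` counts the rows with `i + p i = v`, and this drop is one precisely for `v` in `[t', t + t')`. -/
theorem shape_iff {t t' : ℕ} {p : ℕ → ℕ} (ha : Antitone p) (hp : ∀ i < t, 0 < p i)
    (h0 : ∀ i, t ≤ i → p i = 0) (ht' : 0 < t') : Shape t t' p ↔
      ∀ m, ((Finset.range (m + 1)).filter fun r => m - r < p r).card =
        min (min (m + 1) (min t t')) (t + t' - 1 - m) := by
  have key := card_filter_add t p hp h0
  constructor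
  · intro h m
    have h1 : ((Finset.range t).filter fun i => m < i + p i).card = min t (t + t' - 1 - m) := by
      rw [← Finset.card_image_of_injOn (f := fun i => i + p i)]
      · have : ((Finset.range t).filter fun i => m < i + p i).image (fun i => i + p i) =
            (Finset.Ico t' (t + t')).filter (fun v => m < v) := by
          rw [← h.image_eq, Finset.filter_image]
        rw [this]
        have : (Finset.Ico t' (t + t')).filter (fun v => m < v) =
            Finset.Ico (max t' (m + 1)) (t + t') := by
          ext v
          simp only [Finset.mem_filter, Finset.mem_Ico]
          omega
        rw [this, Nat.card_Ico]
        omega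
      · intro i hi i' hi' e
        exact h.inj i (by simp at hi; omega) i' (by simp at hi'; omega) e
    have := key m
    omega
  · intro h
    have h1 : ∀ m, ((Finset.range t).filter fun i => m < i + p i).card =
        min t (t + t' - 1 - m) := by
      intro m
      have := key m
      have := h m
      omega
    have hlb : ∀ i < t, t' ≤ i + p i := by
      intro i hi
      have h2 : ((Finset.range t).filter fun i => t' - 1 < i + p i) = Finset.range t := by
        apply Finset.eq_of_subset_of_card_le (Finset.filter_subset _ _)
        rw [h1, Finset.card_range]
        omega
      have : i ∈ (Finset.range t).filter fun i => t' - 1 < i + p i := by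
        rw [h2]; simpa using hi
      rw [Finset.mem_filter] at this
      omega
    have hub : ∀ i < t, i + p i < t + t' := by
      intro i hi
      have h2 : ((Finset.range t).filter fun i => t + t' - 1 < i + p i) = ∅ := by
        rw [← Finset.card_eq_zero, h1]
        omega
      by_contra hc
      have : i ∈ (Finset.range t).filter fun i => t + t' - 1 < i + p i := by
        rw [Finset.mem_filter, Finset.mem_range]
        omega
      rw [h2] at this
      simp at this
    have hsurj : Finset.Ico t' (t + t') ⊆ (Finset.range t).image (fun i => i + p i) := by
      intro v hv
      rw [Finset.mem_Ico] at hv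
      by_contra hc
      have h2 : ((Finset.range t).filter fun i => v - 1 < i + p i) =
          ((Finset.range t).filter fun i => v < i + p i) := by
        ext i
        simp only [Finset.mem_filter, Finset.mem_range, and_congr_right_iff]
        intro hi
        have : i + p i ≠ v := fun e => hc (Finset.mem_image.2 ⟨i, by simpa using hi, e⟩)
        omega
      have h3 := h1 (v - 1)
      rw [h2, h1] at h3
      omega
    refine ⟨ha, hp, h0, ?_, hlb, hub⟩
    have hinj : Set.InjOn (fun i => i + p i) (Finset.range t : Set ℕ) := by
      rw [← Finset.card_image_iff]
      apply le_antisymm Finset.card_image_le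
      have := Finset.card_le_card hsurj
      rw [Nat.card_Ico] at this
      rw [Finset.card_range]
      omega
    intro i hi i' hi' e
    exact hinj (by simpa using hi) (by simpa using hi') e

theorem isShape_parts_iff {n d k t t' : ℕ} (hd : 1 ≤ d) (hk : 1 ≤ k)
    (h : t = d ∧ t' = d + k - 1 ∨ t = d + k - 1 ∧ t' = d) (P : n.Partition) :
    IsShape t t' P.parts ↔ (∀ i, diagLength P i = T d k i) ∧ P.parts.card = t := by
  rw [IsShape, and_comm]
  refine and_congr_left fun hc => ?_
  rw [shape_iff (rows_antitone _) (fun i hi => P.parts_pos (rows_mem (by omega)))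
    (fun i hi => rows_of_le (by omega)) (by omega)]
  refine forall_congr' fun i => ?_
  rw [T_eq hk h]
  rfl

/-! ### Partitions of a given shape -/

theorem smallestPart_eq {n : ℕ} {P : n.Partition} {Q : Multiset ℕ} {c s : ℕ} (hc : 0 < c)
    (hQ : ∀ x ∈ Q, s < x) (hP : P.parts = Q + Multiset.replicate c s) : smallestPart P = s := by
  have h1 : s ∈ P.parts := by
    rw [hP, Multiset.mem_add, Multiset.mem_replicate]
    exact Or.inr ⟨hc.ne', rfl⟩
  apply le_antisymm
  · exact Nat.sInf_le h1
  · refine le_csInf ⟨s, h1⟩ ?_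
    intro x hx
    rw [Set.mem_ofPred_eq, hP, Multiset.mem_add, Multiset.mem_replicate] at hx
    rcases hx with hx | hx
    · exact (hQ x hx).le
    · exact hx.2.ge

theorem count_smallest {Q : Multiset ℕ} {c s : ℕ} (hQ : ∀ x ∈ Q, s < x) :
    (Q + Multiset.replicate c s).count s = c := by
  rw [Multiset.count_add, Multiset.count_replicate_self, Multiset.count_eq_zero.2, zero_add]
  exact fun h => (hQ s h).ne rfl

theorem iota_parts {n : ℕ} {P : n.Partition} {Q : Multiset ℕ} {c s : ℕ} (hc : 0 < c)
    (hQ : ∀ x ∈ Q, s < x) (hP : P.parts = Q + Multiset.replicate c s) :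
    (iota P).parts = Q + Multiset.replicate s c := by
  have h1 := smallestPart_eq hc hQ hP
  simp only [iota]
  rw [h1, hP, count_smallest hQ, Multiset.filter_add, Multiset.filter_eq_self.2,
    Multiset.filter_eq_nil.2, add_zero]
  · intro x hx
    simp [(Multiset.mem_replicate.1 hx).2]
  · exact fun x hx => (hQ x hx).ne'

theorem IsShape.exists_parts {n t t' : ℕ} {P : n.Partition} (h : IsShape t t' P.parts)
    (ht : 0 < t) : ∃ m Q, m < t ∧ m < t' ∧ IsShape m (t + t' - m) Q ∧
      (∀ x ∈ Q, t' - m < x) ∧ (∀ x ∈ Q, t - m < x) ∧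
      P.parts = Q + Multiset.replicate (t - m) (t' - m) ∧
      (iota P).parts = Q + Multiset.replicate (t' - m) (t - m) := by
  obtain ⟨m, Q, hm, hm', hQ, e⟩ := h.exists_eq_add ht
  have h1 := fun x hx => hQ.lt_of_mem (x := x) (by omega : m + (t + t' - m) = t + t') hm hx
  have h2 := fun x hx => hQ.lt_of_mem (x := x) (by omega : m + (t + t' - m) = t' + t) hm' hx
  exact ⟨m, Q, hm, hm', hQ, h1, h2, e, iota_parts (by omega) h1 e⟩

/-- The upper part `Q` is a shape for a pair symmetric in `t` and `t'`, and its parts exceed both `t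
- m` and `t' - m`. So the conjugated block is again the block of smallest parts, and a second
conjugation restores the partition. -/
theorem bijOn_iota {n t t' : ℕ} (ht : 0 < t) (ht' : 0 < t') :
    Set.BijOn iota {P : n.Partition | IsShape t t' P.parts}
      {P : n.Partition | IsShape t' t P.parts} := by
  refine ⟨?_, ?_, ?_⟩
  · intro P hP
    obtain ⟨m, Q, hm, hm', hQ, -, -, -, e⟩ := IsShape.exists_parts hP ht
    rw [Set.mem_ofPred_eq, e]
    exact hQ.add_replicate (by omega) hm' hm
  · intro P hP P' hP' h
    obtain ⟨m, Q, hm, hm', hQ, -, h2, e, e'⟩ := IsShape.exists_parts hP ht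
    obtain ⟨m1, Q1, hm1, hm1', hQ1, -, h21, e1, e1'⟩ := IsShape.exists_parts hP' ht
    rw [h, e1'] at e'
    have h3 := replicate_inj_of_lt (by omega) (by omega) h21 h2 e'
    have : m1 = m := by omega
    subst this
    have := add_right_cancel e'
    subst this
    exact Nat.Partition.ext (e.trans e1.symm)
  · intro P hP
    obtain ⟨m, Q, hm, hm', hQ, h1, h2, e, e'⟩ := IsShape.exists_parts hP ht'
    refine ⟨iota P, ?_, ?_⟩
    · rw [Set.mem_ofPred_eq, e']
      exact hQ.add_replicate (by omega) hm' hm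
    · apply Nat.Partition.ext
      rw [iota_parts (by omega) h2 e', e]

theorem ncard_partitions {n : ℕ} {F : Finset (Multiset ℕ)} {p : n.Partition → Prop}
    (h1 : ∀ P, p P ↔ P.parts ∈ F) (h2 : ∀ M ∈ F, (∀ x ∈ M, 0 < x) ∧ M.sum = n) :
    {P : n.Partition | p P}.ncard = F.card := by
  classical
  rw [← Set.ncard_coe_finset, ← Set.ncard_image_of_injective (f := Nat.Partition.parts)
    _ (fun P P' h => Nat.Partition.ext h)]
  congr 1
  ext M
  simp only [Set.mem_image, Set.mem_ofPred_eq, Finset.mem_coe]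
  constructor
  · rintro ⟨P, hP, rfl⟩
    exact (h1 P).1 hP
  · intro hM
    exact ⟨⟨M, fun {i} hi => (h2 M hM).1 i hi, (h2 M hM).2⟩, (h1 _).2 hM, rfl⟩

theorem ncard_isShape {n t t' : ℕ} (hn : n = t * t') (ht' : 0 < t') :
    {P : n.Partition | IsShape t t' P.parts}.ncard = 2 ^ (min t t' - 1) := by
  obtain ⟨F, hF, hc⟩ := exists_finset_isShape t t' (Or.inr ht')
  rw [← hc]
  refine ncard_partitions (fun P => (hF _).symm) ?_
  intro M hM
  rw [hF] at hM
  exact ⟨fun x hx => hM.pos hx, by rw [hM.sum_eq, hn]⟩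

theorem isShape_and_smallestPart_iff {n t t' m : ℕ} (hm : m < t) (hm' : m < t')
    (P : n.Partition) : (IsShape t t' P.parts ∧ smallestPart P = t' - m) ↔
      ∃ Q, IsShape m (t + t' - m) Q ∧ Q + Multiset.replicate (t - m) (t' - m) = P.parts := by
  constructor
  · rintro ⟨h, hs⟩
    obtain ⟨m1, Q, hm1, hm1', hQ, h1, -, e, -⟩ := h.exists_parts (by omega)
    rw [smallestPart_eq (by omega) h1 e] at hs
    have : m1 = m := by omega
    subst this
    exact ⟨Q, hQ, e.symm⟩
  · rintro ⟨Q, hQ, e⟩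
    refine ⟨?_, ?_⟩
    · rw [← e]
      exact hQ.add_replicate (by omega) hm hm'
    · exact smallestPart_eq (by omega) (fun x hx => hQ.lt_of_mem (by omega) hm hx) e.symm

theorem ncard_isShape_smallestPart {n t t' m : ℕ} (hn : n = t * t') (hm : m < t) (hm' : m < t') :
    {P : n.Partition | IsShape t t' P.parts ∧ smallestPart P = t' - m}.ncard = 2 ^ (m - 1) := by
  classical
  obtain ⟨F, hF, hc⟩ := exists_finset_isShape m (t + t' - m) (by omega)
  rw [min_eq_left (by omega)] at hc
  rw [← hc, ← Finset.card_image_of_injective F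
    (add_left_injective (Multiset.replicate (t - m) (t' - m)))]
  refine ncard_partitions ?_ ?_
  · intro P
    rw [isShape_and_smallestPart_iff hm hm', Finset.mem_image]
    simp only [hF]
  · intro M hM
    obtain ⟨Q, hQ, rfl⟩ := Finset.mem_image.1 hM
    rw [hF] at hQ
    have := hQ.add_replicate (t := t) (t' := t') (by omega) hm hm'
    exact ⟨fun x hx => this.pos hx, by rw [this.sum_eq, hn]⟩

theorem exists_rectangle {n t t' : ℕ} (hn : n = t * t') (ht : 0 < t) (ht' : 0 < t') :
    ∃ P : n.Partition, {Q : n.Partition | IsShape t t' Q.parts ∧ smallestPart Q = t'} = {P} ∧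
      P.parts.count t' = t := by
  refine ⟨⟨Multiset.replicate t t', fun {i} hi => ?_, ?_⟩, ?_, ?_⟩
  · rw [(Multiset.mem_replicate.1 hi).2]
    exact ht'
  · rw [Multiset.sum_replicate, smul_eq_mul, hn]
  · ext P
    have := isShape_and_smallestPart_iff ht ht' P
    rw [Nat.sub_zero, Nat.sub_zero, Nat.sub_zero] at this
    rw [Set.mem_ofPred_eq, this, Set.mem_singleton_iff, Nat.Partition.ext_iff]
    constructor
    · rintro ⟨Q, hQ, e⟩
      rw [← e, Multiset.card_eq_zero.1 hQ.1, zero_add]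
    · intro e
      refine ⟨0, ⟨rfl, rows_antitone _, ?_, fun i _ => by simp [rows], ?_, ?_, ?_⟩, ?_⟩
      · intro i hi; omega
      · intro i hi; omega
      · intro i hi; omega
      · intro i hi; omega
      · rw [zero_add]; exact e.symm
  · exact Multiset.count_replicate_self _ _

/-! ### Failure of the strong Lefschetz property in a given degree -/

/-- The degrees `i < d` in which some string that starts in degree at most `i` stops before
degree `j - i`. -/
def shortDegrees (d j : ℕ) (p : ℕ → ℕ) : Set ℕ := {i | i < d ∧ ∃ u ≤ i, u + p u ≤ j - i}

/-- With `j = 2d + k - 3`, the bound `j - i` is at least `d + k - 1` for `i ≤ d - 2`, so the first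
row `m` of the block qualifies, once `m ≤ i`, before and after conjugation; the rows above are
common. For `i = d - 1` the bound is `d + k - 2`: no row of `P` meets it, whereas the block of
`ι(P)` begins on diagonal `d`, and `k ≥ 2`. -/
theorem shortDegrees_iota {n d k : ℕ} (hd : 1 ≤ d) (hk : 2 ≤ k) {P : n.Partition}
    (h : IsShape d (d + k - 1) P.parts) :
    d - 1 ∉ shortDegrees d (2 * d + k - 3) (rows P.parts) ∧
      shortDegrees d (2 * d + k - 3) (rows (iota P).parts) =
        shortDegrees d (2 * d + k - 3) (rows P.parts) ∪ {d - 1} := by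
  constructor
  · rintro ⟨-, u, hu, hle⟩
    have := h.2.lb u (by omega)
    omega
  · obtain ⟨m, Q, hm, hm', hQ, -, -, e, e'⟩ := h.exists_parts (by omega)
    ext i
    have r1 := hQ.rows_add_replicate (t := d) (t' := d + k - 1) (by omega) hm hm'
    have r2 := hQ.rows_add_replicate (t := d + k - 1) (t' := d) (by omega) hm' hm
    simp only [shortDegrees, Set.mem_union, Set.mem_ofPred_eq, Set.mem_singleton_iff, e, e', r1, r2]
    constructor
    · rintro ⟨hi, u, hu, hle⟩
      rcases eq_or_ne i (d - 1) with hid | hid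
      · exact Or.inr hid
      refine Or.inl ⟨hi, ?_⟩
      by_cases hum : u < m
      · rw [if_pos hum] at hle
        exact ⟨u, hu, by rwa [if_pos hum]⟩
      · refine ⟨m, by omega, ?_⟩
        rw [if_neg (lt_irrefl m), if_pos hm]
        omega
    · rintro (⟨hi, u, hu, hle⟩ | rfl)
      · refine ⟨hi, ?_⟩
        by_cases hum : u < m
        · rw [if_pos hum] at hle
          exact ⟨u, hu, by rwa [if_pos hum]⟩
        · refine ⟨m, by omega, ?_⟩
          rw [if_neg (lt_irrefl m), if_pos hm']
          omega
      · refine ⟨by omega, m, by omega, ?_⟩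
        rw [if_neg (lt_irrefl m), if_pos hm']
        omega

/-! ### Strings of an endomorphism -/

section Strings

variable {K V ι : Type*} [Field K] [AddCommGroup V] [Module K V] {φ : Module.End K V}
  {len : ι → ℕ} {b : Module.Basis (Σ i, Fin (len i)) K V}

/-- The basis `b` consists of strings of `φ`. -/
def IsStringBasis (φ : Module.End K V) {len : ι → ℕ} (b : Module.Basis (Σ i, Fin (len i)) K V) :
    Prop :=
  ∀ (i : ι) (s : Fin (len i)), φ (b ⟨i, s⟩) = if h : (s : ℕ) + 1 < len i then b ⟨i, ⟨s + 1, h⟩⟩ else 0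

theorem IsStringBasis.pow_apply (hb : IsStringBasis φ b) (n : ℕ) (i : ι) (s : Fin (len i)) :
    (φ ^ n) (b ⟨i, s⟩) = if h : (s : ℕ) + n < len i then b ⟨i, ⟨s + n, h⟩⟩ else 0 := by
  induction n with
  | zero => simp
  | succ n ih =>
    rw [pow_succ', Module.End.mul_apply, ih]
    by_cases h : (s : ℕ) + n < len i
    · rw [dif_pos h, hb]
      rfl
    · rw [dif_neg h, dif_neg (by omega), map_zero]

theorem IsStringBasis.range_pow (hb : IsStringBasis φ b) (n : ℕ) :
    LinearMap.range (φ ^ n) = Submodule.span K (b '' {v | n ≤ (v.2 : ℕ)}) := by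
  rw [LinearMap.range_eq_map, ← b.span_eq, Submodule.map_span]
  apply le_antisymm
  · rw [Submodule.span_le]
    rintro _ ⟨_, ⟨⟨i, s⟩, rfl⟩, rfl⟩
    rw [SetLike.mem_coe, hb.pow_apply]
    split_ifs with h
    · exact Submodule.subset_span ⟨⟨i, ⟨s + n, h⟩⟩, Nat.le_add_left n s, rfl⟩
    · exact Submodule.zero_mem _
  · rw [Submodule.span_le]
    rintro _ ⟨⟨i, s⟩, hs, rfl⟩
    have hs' : n ≤ (s : ℕ) := hs
    refine Submodule.subset_span ⟨b ⟨i, ⟨s - n, by omega⟩⟩, ⟨_, rfl⟩, ?_⟩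
    rw [hb.pow_apply, dif_pos (show (s : ℕ) - n + n < len i by omega)]
    congr 3
    exact Nat.sub_add_cancel hs'

theorem IsStringBasis.finrank_range_pow [Fintype ι] (hb : IsStringBasis φ b) (n : ℕ) :
    Module.finrank K (LinearMap.range (φ ^ n)) = ∑ i, (len i - n) := by
  classical
  rw [hb.range_pow, Set.image_eq_range]
  refine (finrank_span_eq_card (b.linearIndependent.comp _ Subtype.val_injective)).trans ?_
  rw [Fintype.card_subtype, ← Finset.univ_sigma_univ, Finset.card_filter, Finset.sum_sigma]
  refine Finset.sum_congr rfl fun i _ => ?_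
  rw [← Finset.card_filter]
  have : (Finset.univ.filter fun s : Fin (len i) => n ≤ (s : ℕ)).map Fin.valEmbedding =
      Finset.Ico n (len i) := by
    ext a
    simp only [Finset.mem_map, Finset.mem_filter, Finset.mem_univ, true_and, Finset.mem_Ico,
      Fin.valEmbedding_apply]
    constructor
    · rintro ⟨s, hs, rfl⟩
      exact ⟨hs, s.2⟩
    · rintro ⟨h1, h2⟩
      exact ⟨⟨a, h2⟩, h1, rfl⟩
  rw [← Nat.card_Ico, ← this, Finset.card_map]
  rfl

/-- Consecutive differences of the sums count the indices with `n < f i`. These counts are the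
conjugate partition and determine an antitone `f`. Applied to the ranks of the powers of an
endomorphism, this is the uniqueness of the Jordan type. -/
theorem antitone_eq_of_sum_sub_eq {f g : ℕ → ℕ} {t t' : ℕ} (hf : Antitone f) (hg : Antitone g)
    (hf0 : ∀ i, t ≤ i → f i = 0) (hg0 : ∀ i, t' ≤ i → g i = 0)
    (h : ∀ n, ∑ i : Fin t, (f i - n) = ∑ i : Fin t', (g i - n)) : f = g := by
  have hcard : ∀ (f : ℕ → ℕ) (t n : ℕ), ((Finset.range t).filter fun i => n < f i).card +
      ∑ i ∈ Finset.range t, (f i - (n + 1)) = ∑ i ∈ Finset.range t, (f i - n) := by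
    intro f t n
    rw [Finset.card_filter, ← Finset.sum_add_distrib]
    refine Finset.sum_congr rfl fun i _ => ?_
    split_ifs <;> omega
  have hlt : ∀ (f : ℕ → ℕ) (t : ℕ), Antitone f → (∀ i, t ≤ i → f i = 0) → ∀ n i,
      n < f i ↔ i < ((Finset.range t).filter fun i => n < f i).card := by
    intro f t hf hf0 n i
    constructor
    · intro hi
      have : Finset.range (i + 1) ⊆ (Finset.range t).filter fun i => n < f i := by
        intro u hu
        rw [Finset.mem_range] at hu
        have h1 := hf (by omega : u ≤ i)
        have h2 := hf0 u
        rw [Finset.mem_filter, Finset.mem_range]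
        omega
      have := Finset.card_le_card this
      rw [Finset.card_range] at this
      omega
    · intro hi
      by_contra hc
      have : ((Finset.range t).filter fun i => n < f i) ⊆ Finset.range i := by
        intro u hu
        rw [Finset.mem_filter, Finset.mem_range] at hu
        rw [Finset.mem_range]
        by_contra h1
        have := hf (by omega : i ≤ u)
        omega
      have := Finset.card_le_card this
      rw [Finset.card_range] at this
      omega
  replace h : ∀ n, ∑ i ∈ Finset.range t, (f i - n) = ∑ i ∈ Finset.range t', (g i - n) := by
    intro n
    rw [Finset.sum_range, Finset.sum_range, h]
  have hc : ∀ n, ((Finset.range t).filter fun i => n < f i).card =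
      ((Finset.range t').filter fun i => n < g i).card := by
    intro n
    have h1 := hcard f t n
    have h2 := hcard g t' n
    have h3 := h n
    have h4 := h (n + 1)
    omega
  funext i
  apply le_antisymm
  · by_contra hn
    have := hlt f t hf hf0 (g i) i
    rw [hc, ← hlt g t' hg hg0] at this
    omega
  · by_contra hn
    have := hlt g t' hg hg0 (f i) i
    rw [← hc, ← hlt f t hf hf0] at this
    omega

end Strings

/-! ### Graded algebras generated by two linear forms -/

section PlaneGrading

variable {K A : Type*} [Field K] [CommRing A] [Algebra K A]

/-- `A` is graded with components `𝒜 n` and projections `π n`, and it is generated over `K` by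
the elements `x` and `y` of degree one. -/
structure PlaneGrading (𝒜 : ℕ → Submodule K A) (π : ℕ → A →ₗ[K] A) (x y : A) : Prop where
  proj_mem : ∀ n a, π n a ∈ 𝒜 n
  proj_same : ∀ n, ∀ a ∈ 𝒜 n, π n a = a
  proj_ne : ∀ m n, m ≠ n → ∀ a ∈ 𝒜 m, π n a = 0
  exists_sum : ∀ a, ∃ N, a = ∑ n ∈ Finset.range N, π n a
  mul_mem : ∀ m n, ∀ a ∈ 𝒜 m, ∀ b ∈ 𝒜 n, a * b ∈ 𝒜 (m + n)
  one_mem : 1 ∈ 𝒜 0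
  x_mem : x ∈ 𝒜 1
  y_mem : y ∈ 𝒜 1
  exists_zero : ∀ a ∈ 𝒜 0, ∃ c : K, a = c • 1
  exists_succ : ∀ n, ∀ a ∈ 𝒜 (n + 1), ∃ (c : K) (w : A), w ∈ 𝒜 n ∧ a = c • y ^ (n + 1) + x * w

theorem dvd_smul_of_dvd {a b : A} (c : K) (h : a ∣ b) : a ∣ c • b := by
  rw [Algebra.smul_def]
  exact h.mul_left _

namespace PlaneGrading

variable {𝒜 : ℕ → Submodule K A} {π : ℕ → A →ₗ[K] A} {x y : A}

theorem pow_mem (h : PlaneGrading 𝒜 π x y) {a : A} (ha : a ∈ 𝒜 1) (n : ℕ) : a ^ n ∈ 𝒜 n := by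
  induction n with
  | zero => simpa using h.one_mem
  | succ n ih => rw [pow_succ]; exact h.mul_mem _ _ _ ih _ ha

theorem proj_mul (h : PlaneGrading 𝒜 π x y) {m : ℕ} {a : A} (ha : a ∈ 𝒜 m) (n : ℕ) (b : A) :
    π (m + n) (a * b) = a * π n b := by
  obtain ⟨N, hN⟩ := h.exists_sum b
  conv_lhs => rw [hN, Finset.mul_sum, map_sum]
  conv_rhs => rw [hN, map_sum, Finset.mul_sum]
  refine Finset.sum_congr rfl fun i _ => ?_
  have h1 := h.mul_mem _ _ _ ha _ (h.proj_mem i b)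
  by_cases hi : i = n
  · subst hi
    rw [h.proj_same _ _ h1, h.proj_same _ _ (h.proj_mem i b)]
  · rw [h.proj_ne _ _ (by omega) _ h1, h.proj_ne _ _ hi _ (h.proj_mem i b), mul_zero]

theorem proj_mul_of_lt (h : PlaneGrading 𝒜 π x y) {m n : ℕ} (hn : n < m) {a : A} (ha : a ∈ 𝒜 m)
    (b : A) : π n (a * b) = 0 := by
  obtain ⟨N, hN⟩ := h.exists_sum b
  rw [hN, Finset.mul_sum, map_sum]
  exact Finset.sum_eq_zero fun i _ =>
    h.proj_ne _ _ (by omega) _ (h.mul_mem _ _ _ ha _ (h.proj_mem i b))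

/-- Homogeneous elements `z i = y ^ i + x * w i` of degree `i`. -/
structure Monic (𝒜 : ℕ → Submodule K A) (x y : A) (z : ℕ → A) : Prop where
  mem : ∀ i, z i ∈ 𝒜 i
  dvd : ∀ i, x ∣ z i - y ^ i

variable {z : ℕ → A}

theorem Monic.zero_eq (hz : Monic 𝒜 x y z) (h : PlaneGrading 𝒜 π x y) : z 0 = 1 := by
  obtain ⟨w, hw⟩ := hz.dvd 0
  have h1 := h.proj_mul_of_lt zero_lt_one h.x_mem w
  rw [← hw, map_sub, h.proj_same _ _ (hz.mem 0), pow_zero, h.proj_same _ _ h.one_mem] at h1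
  exact sub_eq_zero.1 h1

theorem Monic.exists_eq_sum (hz : Monic 𝒜 x y z) (h : PlaneGrading 𝒜 π x y) (n : ℕ) :
    ∀ a ∈ 𝒜 n, ∃ c : ℕ → K, a = ∑ i ∈ Finset.range (n + 1), c i • (x ^ (n - i) * z i) := by
  induction n with
  | zero =>
    intro a ha
    obtain ⟨c, rfl⟩ := h.exists_zero a ha
    exact ⟨fun _ => c, by simp [hz.zero_eq h]⟩
  | succ n ih =>
    intro a ha
    obtain ⟨c, w, hw, e⟩ := h.exists_succ n a ha
    obtain ⟨w', hw'⟩ := hz.dvd (n + 1)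
    have e1 : a = c • z (n + 1) + x * (w - c • w') := by
      rw [sub_eq_iff_eq_add'] at hw'
      rw [e, hw', smul_add, mul_sub, mul_smul_comm]
      abel
    -- Only the component of degree `n` of the cofactor matters, and the induction hypothesis
    -- applies to it.
    have e2 : a = c • z (n + 1) + x * π n (w - c • w') := by
      conv_lhs => rw [← h.proj_same _ _ ha, e1, map_add, map_smul, h.proj_same _ _ (hz.mem _),
        add_comm n 1, h.proj_mul h.x_mem]
      rw [add_comm n 1]
    obtain ⟨c', hc'⟩ := ih _ (h.proj_mem n (w - c • w'))
    refine ⟨fun i => if i = n + 1 then c else c' i, ?_⟩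
    rw [Finset.sum_range_succ, e2, hc', Finset.mul_sum, add_comm]
    congr 1
    · refine Finset.sum_congr rfl fun i hi => ?_
      rw [Finset.mem_range] at hi
      simp only [if_neg hi.ne]
      rw [mul_smul_comm, ← mul_assoc, ← pow_succ',
        show n + 1 - i = n - i + 1 by omega]
    · simp

/-- In a relation, take a term `x ^ a * z i` with least exponent `a` and project to its degree. All
other terms of that degree contain a higher power of `x`, so `x ^ (a + 1)` divides `x ^ a * z i`,
hence also `x ^ a * y ^ i`. -/
theorem Monic.linearIndepOn (hz : Monic 𝒜 x y z) (h : PlaneGrading 𝒜 π x y) {Λ : Set (ℕ × ℕ)}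
    (hΛ : ∀ v ∈ Λ, ¬ x ^ (v.2 + 1) ∣ x ^ v.2 * y ^ v.1) :
    LinearIndepOn K (fun v : ℕ × ℕ => x ^ v.2 * z v.1) Λ := by
  classical
  rw [linearIndepOn_iff]
  intro c hc h0
  by_contra hne
  obtain ⟨v, hv, hmin⟩ := c.support.exists_min_image (fun v => v.2)
    (Finsupp.support_nonempty_iff.2 hne)
  have hcv : c v ≠ 0 := Finsupp.mem_support_iff.1 hv
  refine hΛ v (hc hv) ?_
  have hmem : ∀ u : ℕ × ℕ, x ^ u.2 * z u.1 ∈ 𝒜 (u.2 + u.1) := fun u =>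
    h.mul_mem _ _ _ (h.pow_mem h.x_mem _) _ (hz.mem _)
  have h1 : π (v.2 + v.1) (Finsupp.linearCombination K (fun v : ℕ × ℕ => x ^ v.2 * z v.1) c) = 0 := by
    rw [h0, map_zero]
  rw [Finsupp.linearCombination_apply, Finsupp.sum, map_sum,
    ← Finset.add_sum_erase _ _ hv, map_smul, h.proj_same _ _ (hmem v)] at h1
  have h2 : x ^ (v.2 + 1) ∣ ∑ u ∈ c.support.erase v,
      π (v.2 + v.1) (c u • (x ^ u.2 * z u.1)) := by
    refine Finset.dvd_sum fun u hu => ?_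
    rw [Finset.mem_erase] at hu
    rw [map_smul]
    by_cases hd : u.2 + u.1 = v.2 + v.1
    · rw [← hd, h.proj_same _ _ (hmem u)]
      have h3 := hmin u hu.2
      have h4 : u.2 ≠ v.2 := fun e => hu.1 (Prod.ext (by omega) e)
      exact dvd_smul_of_dvd _ ((pow_dvd_pow x (by omega)).mul_right _)
    · rw [h.proj_ne _ _ hd _ (hmem u), smul_zero]
      exact dvd_zero _
  have h3 : x ^ (v.2 + 1) ∣ c v • (x ^ v.2 * z v.1) := by
    rw [eq_neg_of_add_eq_zero_left h1]
    exact (dvd_neg).2 h2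
  have h4 : x ^ (v.2 + 1) ∣ x ^ v.2 * z v.1 := by
    have := dvd_smul_of_dvd (c v)⁻¹ h3
    rwa [smul_smul, inv_mul_cancel₀ hcv, one_smul] at this
  have h5 : x ^ (v.2 + 1) ∣ x ^ v.2 * (z v.1 - y ^ v.1) := by
    rw [pow_succ]
    exact mul_dvd_mul_left _ (hz.dvd _)
  rw [mul_sub] at h5
  exact (dvd_sub_right h4).1 h5

theorem Monic.linearIndependent (hz : Monic 𝒜 x y z) (h : PlaneGrading 𝒜 π x y) {t : ℕ}
    {p : ℕ → ℕ} (hp : ∀ i a, a < p i → ¬ x ^ (a + 1) ∣ x ^ a * y ^ i) :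
    LinearIndependent K (fun v : Σ i : Fin t, Fin (p i) => x ^ (v.2 : ℕ) * z v.1) := by
  have h1 := hz.linearIndepOn h (Λ := {v | v.2 < p v.1}) (fun v hv => hp v.1 v.2 hv)
  refine LinearIndependent.comp h1
    (fun v : Σ i : Fin t, Fin (p i) => ⟨((v.1 : ℕ), (v.2 : ℕ)), v.2.2⟩) ?_
  rintro ⟨⟨i, hi⟩, ⟨s, hs⟩⟩ ⟨⟨i', hi'⟩, ⟨s', hs'⟩⟩ e
  simp only [Subtype.mk.injEq, Prod.mk.injEq] at e
  obtain ⟨rfl, rfl⟩ := e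
  rfl

theorem Monic.mem_span (hz : Monic 𝒜 x y z) (h : PlaneGrading 𝒜 π x y) {t : ℕ} {p : ℕ → ℕ}
    (hp : ∀ i, x ^ p i * z i = 0) (ht : ∀ i, t ≤ i → p i = 0) {n : ℕ} {a : A} (ha : a ∈ 𝒜 n) :
    a ∈ Submodule.span K ((fun v : Σ i : Fin t, Fin (p i) => x ^ (v.2 : ℕ) * z v.1) ''
      {v | (v.1 : ℕ) + v.2 = n}) := by
  obtain ⟨c, rfl⟩ := hz.exists_eq_sum h n a ha
  refine Submodule.sum_mem _ fun i hi => Submodule.smul_mem _ _ ?_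
  rw [Finset.mem_range] at hi
  by_cases hlt : n - i < p i
  · have hit : i < t := by
      by_contra hc
      have := ht i (by omega)
      omega
    exact Submodule.subset_span ⟨⟨⟨i, hit⟩, ⟨n - i, hlt⟩⟩, by simp; omega, rfl⟩
  · rw [show n - i = (n - i - p i) + p i by omega, pow_add, mul_assoc, hp, mul_zero]
    exact Submodule.zero_mem _

theorem Monic.span_eq_top (hz : Monic 𝒜 x y z) (h : PlaneGrading 𝒜 π x y) {t : ℕ} {p : ℕ → ℕ}
    (hp : ∀ i, x ^ p i * z i = 0) (ht : ∀ i, t ≤ i → p i = 0) :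
    Submodule.span K (Set.range
      (fun v : Σ i : Fin t, Fin (p i) => x ^ (v.2 : ℕ) * z v.1)) = ⊤ := by
  rw [eq_top_iff]
  intro a _
  obtain ⟨N, hN⟩ := h.exists_sum a
  rw [hN]
  refine Submodule.sum_mem _ fun n _ => ?_
  exact Submodule.span_mono (Set.image_subset_range _ _) (hz.mem_span h hp ht (h.proj_mem n a))

theorem isStringBasis_of_pow {ι : Type*} {len : ι → ℕ}
    {b : Module.Basis (Σ i, Fin (len i)) K A} {g : ι → A}
    (hb : ∀ v, b v = x ^ (v.2 : ℕ) * g v.1) (hg : ∀ i, x ^ len i * g i = 0) :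
    IsStringBasis (LinearMap.mulLeft K x) b := by
  intro i s
  rw [LinearMap.mulLeft_apply, hb]
  split_ifs with hs
  · rw [hb]
    simp only
    ring
  · have : (s : ℕ) + 1 = len i := by omega
    simp only
    rw [← hg i, ← mul_assoc, ← pow_succ', this]

/-! ### The heights of the strings -/

/-- The least `s` such that `x ^ s * y ^ i` is divisible by `x ^ (s + 1)`. -/
noncomputable def height (x y : A) (i : ℕ) : ℕ := sInf {s | x ^ (s + 1) ∣ x ^ s * y ^ i}

theorem dvd_of_height_le (hx : IsNilpotent x) {i a : ℕ} (ha : height x y i ≤ a) :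
    x ^ (a + 1) ∣ x ^ a * y ^ i := by
  have h1 : x ^ (height x y i + 1) ∣ x ^ height x y i * y ^ i := by
    refine Nat.sInf_mem (s := {s | x ^ (s + 1) ∣ x ^ s * y ^ i}) ?_
    obtain ⟨N, hN⟩ := hx
    exact ⟨N, by rw [Set.mem_ofPred_eq, hN, zero_mul]; exact dvd_zero _⟩
  obtain ⟨r, rfl⟩ := Nat.exists_eq_add_of_le ha
  rw [add_right_comm, pow_add, pow_add x _ r, mul_right_comm]
  exact mul_dvd_mul_right h1 _

theorem not_dvd_of_lt_height {i a : ℕ} (ha : a < height x y i) :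
    ¬ x ^ (a + 1) ∣ x ^ a * y ^ i := fun h => Nat.notMem_of_lt_sInf ha h

theorem height_antitone (hx : IsNilpotent x) : Antitone (height x y) := by
  intro i i' hi
  refine Nat.sInf_le ?_
  obtain ⟨r, rfl⟩ := Nat.exists_eq_add_of_le hi
  rw [Set.mem_ofPred_eq, pow_add y, ← mul_assoc]
  exact (dvd_of_height_le hx le_rfl).mul_right _

/-- Write `x ^ h * y ^ i = x ^ (h + 1) * w` with `h` the height. Replacing `w` by its component of
degree `i - 1` keeps the equation, and `y ^ i - x * w` is then annihilated by `x ^ h`. For `i = 0`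
the right side has no component of degree `h`, so `x ^ h = 0`. -/
theorem exists_monic (h : PlaneGrading 𝒜 π x y) (hx : IsNilpotent x) :
    ∃ z, Monic 𝒜 x y z ∧ ∀ i, x ^ height x y i * z i = 0 := by
  have key : ∀ i, ∃ a, a ∈ 𝒜 i ∧ x ∣ a - y ^ i ∧ x ^ height x y i * a = 0 := by
    intro i
    obtain ⟨w, hw⟩ := dvd_of_height_le hx (le_refl (height x y i))
    have h1 : x ^ height x y i * y ^ i ∈ 𝒜 (height x y i + i) :=
      h.mul_mem _ _ _ (h.pow_mem h.x_mem _) _ (h.pow_mem h.y_mem _)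
    have h2 := h.proj_same _ _ h1
    rw [hw] at h2
    rcases i with _ | i
    · rw [h.proj_mul_of_lt (by omega) (h.pow_mem h.x_mem _), ← hw] at h2
      exact ⟨1, h.one_mem, by simp, by simpa using h2.symm⟩
    · rw [← add_assoc, add_right_comm, h.proj_mul (h.pow_mem h.x_mem _), ← hw] at h2
      refine ⟨y ^ (i + 1) - x * π i w, ?_, ⟨-π i w, by ring⟩, ?_⟩
      · refine Submodule.sub_mem _ (h.pow_mem h.y_mem _) ?_
        rw [add_comm i 1]
        exact h.mul_mem _ _ _ h.x_mem _ (h.proj_mem _ _)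
      · rw [mul_sub, ← h2]
        ring
  choose z hz1 hz2 hz3 using key
  exact ⟨z, ⟨hz1, hz2⟩, hz3⟩

theorem exists_height_eq_zero (h : PlaneGrading 𝒜 π x y) (hx : IsNilpotent x)
    [FiniteDimensional K A] : ∃ t, height x y t = 0 := by
  by_contra hc
  push Not at hc
  obtain ⟨z, hz, -⟩ := h.exists_monic hx
  have h1 := hz.linearIndependent h (t := Module.finrank K A + 1) (p := height x y)
    (fun i a ha => not_dvd_of_lt_height ha)
  have h2 := h1.comp (fun i : Fin (Module.finrank K A + 1) =>
    (⟨i, ⟨0, Nat.pos_of_ne_zero (hc i)⟩⟩ : Σ i : Fin (Module.finrank K A + 1),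
      Fin (height x y i))) (fun i i' e => by simpa using (Sigma.mk.inj_iff.1 e).1)
  have := h2.fintype_card_le_finrank
  rw [Fintype.card_fin] at this
  omega

/-- A string basis with homogeneous generators. -/
theorem exists_basis (h : PlaneGrading 𝒜 π x y) (hx : IsNilpotent x) [FiniteDimensional K A] :
    ∃ (t : ℕ) (z : ℕ → A) (b : Module.Basis (Σ i : Fin t, Fin (height x y i)) K A),
      (∀ i, i < t ↔ 0 < height x y i) ∧ Monic 𝒜 x y z ∧ (∀ i, x ^ height x y i * z i = 0) ∧
      ∀ v, b v = x ^ (v.2 : ℕ) * z v.1 := by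
  classical
  obtain ⟨z, hz, hz0⟩ := h.exists_monic hx
  have hex := h.exists_height_eq_zero hx
  have ht : ∀ i, Nat.find hex ≤ i → height x y i = 0 := fun i hi =>
    Nat.le_zero.1 ((height_antitone hx hi).trans (Nat.find_spec hex).le)
  refine ⟨Nat.find hex, z, Module.Basis.mk (hz.linearIndependent h
    (fun i a ha => not_dvd_of_lt_height ha)) (hz.span_eq_top h hz0 ht).ge, ?_, hz, hz0, ?_⟩
  · intro i
    constructor
    · intro hi
      exact Nat.pos_of_ne_zero (Nat.find_min hex hi)
    · intro hi
      by_contra hc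
      have := ht i (by omega)
      omega
  · intro v
    rw [Module.Basis.mk_apply]

/-- The heights are the lengths of one string basis of `x` and `p` those of another, and both are
determined by the ranks of the powers of `x`. -/
theorem height_eq (h : PlaneGrading 𝒜 π x y) {t : ℕ} {p : ℕ → ℕ}
    (hp : Antitone p) (hp0 : ∀ i, t ≤ i → p i = 0)
    (b : Module.Basis (Σ i : Fin t, Fin (p i)) K A)
    (hb : IsStringBasis (LinearMap.mulLeft K x) b) : IsNilpotent x ∧ height x y = p := by
  have : FiniteDimensional K A := Module.Finite.of_basis b
  have hx : IsNilpotent x := by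
    refine ⟨p 0, ?_⟩
    have h1 : (LinearMap.mulLeft K x) ^ p 0 = 0 := by
      refine b.ext fun v => ?_
      rw [hb.pow_apply, dif_neg, LinearMap.zero_apply]
      have := hp (Nat.zero_le v.1)
      omega
    have h2 := congrArg (fun f => f 1) h1
    simpa [LinearMap.pow_mulLeft] using h2
  refine ⟨hx, ?_⟩
  obtain ⟨t', z, b', ht', hz, hz0, hb'⟩ := h.exists_basis hx
  have hs : IsStringBasis (LinearMap.mulLeft K x) b' :=
    isStringBasis_of_pow (g := fun i : Fin t' => z i) hb' (fun i => hz0 i)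
  refine antitone_eq_of_sum_sub_eq (t := t') (t' := t) (height_antitone hx) hp ?_ hp0 ?_
  · intro i hi
    have := ht' i
    omega
  · intro n
    rw [← hs.finrank_range_pow, ← hb.finrank_range_pow]

/-- In every decomposition into strings with homogeneous generators, there is exactly one string
starting in each degree `i < t`, and its length is `height x y i`. -/
theorem strings_unique (h : PlaneGrading 𝒜 π x y) (hx : IsNilpotent x) {ι : Type*} [Fintype ι]
    {len deg : ι → ℕ} {g : ι → A} (hlen : ∀ u, 0 < len u) (hg : ∀ u, g u ∈ 𝒜 (deg u))
    (b : Module.Basis (Σ i, Fin (len i)) K A) (hb : ∀ v, b v = x ^ (v.2 : ℕ) * g v.1)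
    (hg0 : ∀ i, x ^ len i * g i = 0) :
    Function.Injective deg ∧ (∀ u, len u = height x y (deg u)) ∧
      ∀ i, 0 < height x y i → ∃ u, deg u = i := by
  classical
  have : FiniteDimensional K A := Module.Finite.of_basis b
  have hs : IsStringBasis (LinearMap.mulLeft K x) b := isStringBasis_of_pow hb hg0
  -- A multiple of `x ^ n` has no coordinates in the first `n` places of any string.
  have hdvd : ∀ n a, x ^ n ∣ a → ∀ v, (v.2 : ℕ) < n → b.repr a v = 0 := by
    rintro n _ ⟨w, rfl⟩ v hv
    have h1 : x ^ n * w ∈ LinearMap.range ((LinearMap.mulLeft K x) ^ n) :=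
      ⟨w, by rw [LinearMap.pow_mulLeft, LinearMap.mulLeft_apply]⟩
    rw [hs.range_pow, b.mem_span_image] at h1
    by_contra hc
    have := h1 (Finsupp.mem_support_iff.2 hc)
    rw [Set.mem_ofPred_eq] at this
    omega
  -- Modulo `x`, a homogeneous element is a scalar multiple of a power of `y`.
  have hdec : ∀ u, ∃ c : K, x ∣ g u - c • y ^ deg u := by
    intro u
    have h1 := hg u
    rcases hd : deg u with _ | n
    · rw [hd] at h1
      obtain ⟨c, hc⟩ := h.exists_zero _ h1
      exact ⟨c, by rw [hc, pow_zero, sub_self]; exact dvd_zero _⟩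
    · rw [hd] at h1
      obtain ⟨c, w, -, hc⟩ := h.exists_succ _ _ h1
      exact ⟨c, by rw [hc, add_sub_cancel_left]; exact dvd_mul_right _ _⟩
  choose c hc using hdec
  have hrepr : ∀ u u', b.repr (g u) ⟨u', ⟨0, hlen u'⟩⟩ = if u = u' then 1 else 0 := by
    intro u u'
    have h1 : g u = b ⟨u, ⟨0, hlen u⟩⟩ := by rw [hb]; simp
    rw [h1, b.repr_self, Finsupp.single_apply]
    congr 1
    refine propext ⟨fun e => (Sigma.mk.inj_iff.1 e).1, ?_⟩
    rintro rfl
    rfl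
  have hc0 : ∀ u, c u ≠ 0 := by
    intro u h0
    have h1 := hc u
    rw [h0, zero_smul, sub_zero, ← pow_one x] at h1
    have := hdvd 1 _ h1 ⟨u, ⟨0, hlen u⟩⟩ zero_lt_one
    rw [hrepr, if_pos rfl] at this
    exact one_ne_zero this
  -- Two generators of the same degree would have a combination divisible by `x` with a nonzero
  -- coordinate at the start of a string.
  have hinj : Function.Injective deg := by
    intro u u' e
    by_contra hne
    have h1 : x ^ 1 ∣ c u' • g u - c u • g u' := by
      have h2 := dvd_sub (dvd_smul_of_dvd (c u') (hc u)) (dvd_smul_of_dvd (c u) (hc u'))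
      rw [e, smul_sub, smul_sub, smul_comm (c u') (c u), sub_sub_sub_cancel_right] at h2
      rwa [pow_one]
    have := hdvd 1 _ h1 ⟨u, ⟨0, hlen u⟩⟩ zero_lt_one
    rw [map_sub, map_smul, map_smul, Finsupp.sub_apply, Finsupp.smul_apply, Finsupp.smul_apply,
      hrepr, hrepr, if_pos rfl, if_neg (Ne.symm hne)] at this
    simp [hc0] at this
  have hle : ∀ u, len u ≤ height x y (deg u) := by
    intro u
    by_contra hlt
    push Not at hlt
    have h1 : x ^ (len u - 1 + 1) ∣ x ^ (len u - 1) * y ^ deg u :=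
      dvd_of_height_le hx (by omega)
    have h2 : x ^ (len u - 1 + 1) ∣ x ^ (len u - 1) * g u := by
      have h3 : x ^ (len u - 1 + 1) ∣ x ^ (len u - 1) * (g u - c u • y ^ deg u) := by
        rw [pow_succ]
        exact mul_dvd_mul_left _ (hc u)
      rw [mul_sub, mul_smul_comm] at h3
      exact (dvd_sub_left (dvd_smul_of_dvd _ h1)).1 h3
    have h4 := hdvd _ _ h2 ⟨u, ⟨len u - 1, by have := hlen u; omega⟩⟩ (Nat.lt_succ_self _)
    rw [← hb ⟨u, ⟨len u - 1, by have := hlen u; omega⟩⟩, b.repr_self,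
      Finsupp.single_eq_same] at h4
    exact one_ne_zero h4
  obtain ⟨t, z, b', ht, hz, hz0, hb'⟩ := h.exists_basis hx
  -- Both sums are the dimension of `A`. The lengths are bounded by the heights at distinct degrees
  -- below `t`, so every bound is attained and no degree is omitted.
  have hsum : ∑ u, len u = ∑ i ∈ Finset.range t, height x y i := by
    have h1 := Module.finrank_eq_card_basis b
    have h2 := Module.finrank_eq_card_basis b'
    rw [h1] at h2
    simpa [Finset.sum_range] using h2
  have himg : Finset.univ.image deg ⊆ Finset.range t := by
    intro i hi
    obtain ⟨u, -, rfl⟩ := Finset.mem_image.1 hi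
    rw [Finset.mem_range, ht]
    exact (hlen u).trans_le (hle u)
  have hsum1 : ∑ u, len u ≤ ∑ u, height x y (deg u) := Finset.sum_le_sum fun u _ => hle u
  have hsum2 : ∑ u, height x y (deg u) = ∑ i ∈ Finset.univ.image deg, height x y i :=
    (Finset.sum_image fun u _ u' _ e => hinj e).symm
  have hsum3 : ∑ i ∈ Finset.univ.image deg, height x y i ≤ ∑ i ∈ Finset.range t, height x y i :=
    Finset.sum_le_sum_of_subset himg
  refine ⟨hinj, ?_, ?_⟩
  · have h1 : ∑ u, len u = ∑ u, height x y (deg u) := by omega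
    have := (Finset.sum_eq_sum_iff_of_le fun u _ => hle u).1 h1
    exact fun u => this u (Finset.mem_univ u)
  · intro i hi
    by_contra hno
    push Not at hno
    have h1 : i ∉ Finset.univ.image deg := by
      intro hm
      obtain ⟨u, -, e⟩ := Finset.mem_image.1 hm
      exact hno u e
    have h2 : ∑ i ∈ Finset.univ.image deg, height x y i < ∑ i ∈ Finset.range t, height x y i :=
      Finset.sum_lt_sum_of_subset himg (Finset.mem_range.2 ((ht i).2 hi)) h1 hi
        (fun _ _ _ => Nat.zero_le _)
    omega

end PlaneGrading

end PlaneGrading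

namespace PlaneGrading

variable {K A : Type*} [Field K] [CommRing A] [Algebra K A] {𝒜 : ℕ → Submodule K A}
  {π : ℕ → A →ₗ[K] A} {x y : A}

/-- The strong Lefschetz property fails in degree `i` if and only if a string that starts in
degree at most `i` is too short. -/
theorem exists_pow_mul_eq_zero_iff (h : PlaneGrading 𝒜 π x y) (hx : IsNilpotent x) {i e : ℕ}
    (hi : ∀ u ≤ i, i < u + height x y u) :
    (∃ a ∈ 𝒜 i, a ≠ 0 ∧ x ^ e * a = 0) ↔ ∃ u ≤ i, u + height x y u ≤ e + i := by
  obtain ⟨z, hz, hz0⟩ := h.exists_monic hx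
  -- The elements `x ^ (i - u) * z u`, `u ≤ i`, span degree `i`. Multiplied by `x ^ e` they stay
  -- independent as long as none of these strings has stopped; the case `e = 0` is the hypothesis
  -- `hi`.
  have hli : ∀ e, (∀ u ≤ i, e + i < u + height x y u) →
      LinearIndependent K (fun u : Fin (i + 1) => x ^ (e + i - u) * z u) := by
    intro e he
    have h1 := hz.linearIndepOn h (Λ := {v | v.2 < height x y v.1})
      (fun v hv => not_dvd_of_lt_height hv)
    refine LinearIndependent.comp h1 (fun u : Fin (i + 1) => ⟨((u : ℕ), e + i - u), ?_⟩) ?_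
    · rw [Set.mem_ofPred_eq]
      have := he u (by omega)
      dsimp only
      omega
    · intro u u' huu
      simp only [Subtype.mk.injEq, Prod.mk.injEq] at huu
      exact Fin.ext huu.1
  constructor
  · rintro ⟨a, ha, hne, h0⟩
    by_contra hc
    push Not at hc
    obtain ⟨c, rfl⟩ := hz.exists_eq_sum h i a ha
    rw [Finset.mul_sum, Finset.sum_range] at h0
    have h1 := Fintype.linearIndependent_iff.1 (hli e hc) (fun u => c u) (by
      rw [← h0]
      refine Finset.sum_congr rfl fun u _ => ?_
      rw [mul_smul_comm, ← mul_assoc, ← pow_add]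
      congr 3
      have := u.2
      omega)
    refine hne (Finset.sum_eq_zero fun u hu => ?_)
    rw [Finset.mem_range] at hu
    have := h1 ⟨u, hu⟩
    simp only at this
    rw [this, zero_smul]
  · rintro ⟨u, hu, hle⟩
    refine ⟨x ^ (i - u) * z u, ?_, ?_, ?_⟩
    · have := h.mul_mem _ _ _ (h.pow_mem h.x_mem (i - u)) _ (hz.mem u)
      rwa [Nat.sub_add_cancel hu] at this
    · have := (hli 0 (fun u hu => by rw [zero_add]; exact hi u hu)).ne_zero ⟨u, by omega⟩
      rwa [zero_add] at this
    · rw [← mul_assoc, ← pow_add,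
        show e + (i - u) = (e + i - u - height x y u) + height x y u by omega, pow_add,
        mul_assoc, hz0, mul_zero]

end PlaneGrading

/-! ### The polynomial ring in two variables and its graded quotients -/

section Quotients

variable {K : Type*} [Field K]

theorem degree_fin_two (e : Fin 2 →₀ ℕ) : e.degree = e 0 + e 1 := by
  rw [Finsupp.degree_eq_sum, Fin.sum_univ_two]

theorem eq_of_isHomogeneous_one {m : MvPolynomial (Fin 2) K} (hm : m.IsHomogeneous 1) :
    m = m.coeff (Finsupp.single 0 1) • X 0 + m.coeff (Finsupp.single 1 1) • X 1 := by
  classical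
  ext e
  rw [coeff_add, coeff_smul, coeff_smul, coeff_X, coeff_X]
  by_cases he : e.degree = 1
  · rw [degree_fin_two] at he
    rcases (by omega : e 0 = 1 ∧ e 1 = 0 ∨ e 0 = 0 ∧ e 1 = 1) with h | h
    · have : e = Finsupp.single 0 1 := by
        ext i; fin_cases i <;> simp [h]
      subst this
      simp [Finsupp.single_left_inj]
    · have : e = Finsupp.single 1 1 := by
        ext i; fin_cases i <;> simp [h]
      subst this
      simp [Finsupp.single_left_inj]
  · rw [hm.coeff_eq_zero he, if_neg, if_neg]
    · simp
    · rintro rfl; simp at he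
    · rintro rfl; simp at he

theorem exists_decomposition {m y : MvPolynomial (Fin 2) K} (hy : y.IsHomogeneous 1) (hX : ∀ s : Fin 2, ∃ α β : K, X s = α • y + β • m) (n : ℕ) :
    ∀ r : MvPolynomial (Fin 2) K, r.IsHomogeneous (n + 1) →
      ∃ (c : K) (w : MvPolynomial (Fin 2) K), w.IsHomogeneous n ∧ r = c • y ^ (n + 1) + m * w := by
  have key : ∀ n, ∀ e : Fin 2 →₀ ℕ, e.degree = n + 1 →
      ∃ (c : K) (w : MvPolynomial (Fin 2) K), w.IsHomogeneous n ∧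
        monomial e 1 = c • y ^ (n + 1) + m * w := by
    intro n
    induction n with
    | zero =>
      intro e he
      obtain ⟨s, rfl⟩ : ∃ s, e = Finsupp.single s 1 := by
        rw [degree_fin_two] at he
        rcases (by omega : e 0 = 1 ∧ e 1 = 0 ∨ e 0 = 0 ∧ e 1 = 1) with h | h
        · exact ⟨0, by ext i; fin_cases i <;> simp [h]⟩
        · exact ⟨1, by ext i; fin_cases i <;> simp [h]⟩
      obtain ⟨α, β, h⟩ := hX s
      refine ⟨α, C β, isHomogeneous_C _ _, ?_⟩
      have h1 : monomial (Finsupp.single s 1) (1 : K) = X s := rfl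
      rw [h1, h, zero_add, pow_one, mul_comm m, C_mul']
    | succ n ih =>
      intro e he
      obtain ⟨s, hs⟩ : ∃ s, 0 < e s := by
        rw [degree_fin_two] at he
        rcases Nat.eq_zero_or_pos (e 0) with h | h
        · exact ⟨1, by omega⟩
        · exact ⟨0, h⟩
      have hle : Finsupp.single s 1 ≤ e := by
        rw [Finsupp.single_le_iff]; exact hs
      have he' : (e - Finsupp.single s 1).degree = n + 1 := by
        have h1 := congrArg Finsupp.degree (tsub_add_cancel_of_le hle)
        rw [map_add, Finsupp.degree_single] at h1
        omega
      obtain ⟨c, w, hw, h1⟩ := ih _ he'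
      obtain ⟨α, β, h2⟩ := hX s
      have h3 : monomial e (1 : K) = X s * monomial (e - Finsupp.single s 1) 1 := by
        rw [X, monomial_mul, one_mul, add_tsub_cancel_of_le hle]
      refine ⟨c * α, (c * β) • y ^ (n + 1) + X s * w, ?_, ?_⟩
      · refine IsHomogeneous.add ?_ ?_
        · have := (hy.pow (n + 1)).C_mul (c * β)
          rwa [one_mul, ← smul_eq_C_mul] at this
        · have := (isHomogeneous_X K s).mul hw
          rwa [add_comm 1 n] at this
      · rw [h3, h1, mul_add, h2]
        simp only [smul_eq_C_mul, C_mul]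
        ring
  intro r hr
  have hr' : r ∈ Submodule.span K {y ^ (n + 1)} ⊔
      (homogeneousSubmodule (Fin 2) K n).map (LinearMap.mulLeft K m) := by
    rw [r.as_sum]
    refine Submodule.sum_mem _ fun e he => ?_
    have h1 : monomial e (coeff e r) = coeff e r • monomial e (1 : K) := by
      rw [smul_monomial, smul_eq_mul, mul_one]
    obtain ⟨c, w, hw, h2⟩ := key n e (by
      by_contra hc
      exact (mem_support_iff.1 he) (hr.coeff_eq_zero hc))
    rw [h1, h2]
    refine Submodule.smul_mem _ _ (Submodule.add_mem_sup ?_ ⟨w, hw, rfl⟩)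
    exact Submodule.smul_mem _ _ (Submodule.mem_span_singleton_self _)
  obtain ⟨a, ha, _, ⟨w, hw, rfl⟩, rfl⟩ := Submodule.mem_sup.1 hr'
  obtain ⟨c, rfl⟩ := Submodule.mem_span_singleton.1 ha
  exact ⟨c, w, hw, rfl⟩

theorem exists_complement {m : MvPolynomial (Fin 2) K} (hm : m.IsHomogeneous 1) (h0 : m ≠ 0) :
    ∃ y : MvPolynomial (Fin 2) K, y.IsHomogeneous 1 ∧
      ∀ s : Fin 2, ∃ α β : K, X s = α • y + β • m := by
  have e := eq_of_isHomogeneous_one hm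
  set a := m.coeff (Finsupp.single 0 1)
  set b := m.coeff (Finsupp.single 1 1)
  by_cases ha : a = 0
  · have hb : b ≠ 0 := by
      intro hb
      rw [ha, hb] at e
      exact h0 (by simpa using e)
    refine ⟨X 0, isHomogeneous_X _ _, ?_⟩
    intro s
    fin_cases s
    · exact ⟨1, 0, by simp⟩
    · refine ⟨0, b⁻¹, ?_⟩
      rw [e, ha]
      simp [smul_smul, hb]
  · refine ⟨X 1, isHomogeneous_X _ _, ?_⟩
    intro s
    fin_cases s
    · refine ⟨-(a⁻¹ * b), a⁻¹, ?_⟩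
      rw [e]
      simp [smul_smul, ha]
    · exact ⟨1, 0, by simp⟩

theorem planeGrading_polynomial {m y : MvPolynomial (Fin 2) K} (hm : m.IsHomogeneous 1)
    (hy : y.IsHomogeneous 1) (hX : ∀ s : Fin 2, ∃ α β : K, X s = α • y + β • m) :
    PlaneGrading (homogeneousSubmodule (Fin 2) K) homogeneousComponent m y where
  proj_mem n a := homogeneousComponent_mem n a
  proj_same n a ha := by rw [homogeneousComponent_of_mem ha, if_pos rfl]
  proj_ne m n hmn a ha := by rw [homogeneousComponent_of_mem ha, if_neg (Ne.symm hmn)]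
  exists_sum a := ⟨_, (sum_homogeneousComponent a).symm⟩
  mul_mem _ _ _ ha _ hb := IsHomogeneous.mul ha hb
  one_mem := isHomogeneous_one _ _
  x_mem := hm
  y_mem := hy
  exists_zero a ha := by
    refine ⟨coeff 0 a, ?_⟩
    have h1 := homogeneousComponent_zero a
    rw [homogeneousComponent_of_mem ha, if_pos rfl] at h1
    rw [← C_mul', mul_one]
    exact h1
  exists_succ n a ha := by
    obtain ⟨c, w, hw, e⟩ := exists_decomposition hy hX n a ha
    exact ⟨c, w, hw, e⟩

theorem planeGrading_X : PlaneGrading (homogeneousSubmodule (Fin 2) K) homogeneousComponent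
    (X 0 : MvPolynomial (Fin 2) K) (X 1) := by
  refine planeGrading_polynomial (isHomogeneous_X _ _) (isHomogeneous_X _ _) ?_
  intro s
  fin_cases s
  · exact ⟨0, 1, by simp⟩
  · exact ⟨1, 0, by simp⟩

/-- `I` contains the homogeneous components of its elements. -/
def IsGradedIdeal (I : Ideal (MvPolynomial (Fin 2) K)) : Prop :=
  ∀ r ∈ I, ∀ n, homogeneousComponent n r ∈ I

theorem IsGradedCI.isGradedIdeal {I : Ideal (MvPolynomial (Fin 2) K)} (hI : IsGradedCI I) :
    IsGradedIdeal I := by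
  obtain ⟨f, g, m, n, hf, hg, -, rfl⟩ := hI
  have key : ∀ (p : MvPolynomial (Fin 2) K) (m : ℕ), p.IsHomogeneous m → ∀ q i,
      p ∣ homogeneousComponent i (p * q) := by
    intro p m hp q i
    rcases lt_or_ge i m with hi | hi
    · rw [planeGrading_X.proj_mul_of_lt hi hp]
      exact dvd_zero _
    · obtain ⟨r, rfl⟩ := Nat.exists_eq_add_of_le hi
      rw [planeGrading_X.proj_mul hp]
      exact dvd_mul_right _ _
  intro r hr i
  obtain ⟨a, b, rfl⟩ := Ideal.mem_span_pair.1 hr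
  obtain ⟨a', ha'⟩ := key f m hf a i
  obtain ⟨b', hb'⟩ := key g n hg b i
  rw [map_add, mul_comm a, mul_comm b, ha', hb', mul_comm f, mul_comm g]
  exact Ideal.mem_span_pair.2 ⟨a', b', rfl⟩

/-- The projection of the quotient by a graded ideal onto its component of degree `n`. -/
noncomputable def quotProj {I : Ideal (MvPolynomial (Fin 2) K)} (hI : IsGradedIdeal I) (n : ℕ) :
    (MvPolynomial (Fin 2) K ⧸ I) →ₗ[K] (MvPolynomial (Fin 2) K ⧸ I) :=
  ((I.restrictScalars K).liftQ ((Ideal.Quotient.mkₐ K I).toLinearMap ∘ₗ homogeneousComponent n)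
    (fun r hr => by
      rw [LinearMap.mem_ker]
      exact Ideal.Quotient.eq_zero_iff_mem.2 (hI r hr n))) ∘ₗ
    (Submodule.Quotient.restrictScalarsEquiv K I).symm.toLinearMap

theorem quotProj_mk {I : Ideal (MvPolynomial (Fin 2) K)} (hI : IsGradedIdeal I) (n : ℕ)
    (r : MvPolynomial (Fin 2) K) : quotProj hI n (Ideal.Quotient.mk I r) =
      Ideal.Quotient.mk I (homogeneousComponent n r) := rfl

theorem mem_gradedPiece {I : Ideal (MvPolynomial (Fin 2) K)} {n : ℕ}
    {a : MvPolynomial (Fin 2) K ⧸ I} : a ∈ gradedPiece I n ↔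
      ∃ r : MvPolynomial (Fin 2) K, r.IsHomogeneous n ∧ Ideal.Quotient.mk I r = a := Iff.rfl

theorem mk_mem_gradedPiece {I : Ideal (MvPolynomial (Fin 2) K)} {n : ℕ}
    {r : MvPolynomial (Fin 2) K} (hr : r.IsHomogeneous n) :
    Ideal.Quotient.mk I r ∈ gradedPiece I n := ⟨r, hr, rfl⟩

theorem mk_smul {I : Ideal (MvPolynomial (Fin 2) K)} (c : K) (r : MvPolynomial (Fin 2) K) :
    Ideal.Quotient.mk I (c • r) = c • Ideal.Quotient.mk I r := rfl

theorem planeGrading_quotient {I : Ideal (MvPolynomial (Fin 2) K)} (hI : IsGradedIdeal I)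
    {m y : MvPolynomial (Fin 2) K}
    (h : PlaneGrading (homogeneousSubmodule (Fin 2) K) homogeneousComponent m y) :
    PlaneGrading (gradedPiece I) (quotProj hI) (Ideal.Quotient.mk I m)
      (Ideal.Quotient.mk I y) where
  proj_mem n a := by
    obtain ⟨r, rfl⟩ := Ideal.Quotient.mk_surjective a
    exact mk_mem_gradedPiece (h.proj_mem n r)
  proj_same n a ha := by
    obtain ⟨r, hr, rfl⟩ := mem_gradedPiece.1 ha
    rw [quotProj_mk, h.proj_same n r hr]
  proj_ne m n hmn a ha := by
    obtain ⟨r, hr, rfl⟩ := mem_gradedPiece.1 ha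
    rw [quotProj_mk, h.proj_ne m n hmn r hr, map_zero]
  exists_sum a := by
    obtain ⟨r, rfl⟩ := Ideal.Quotient.mk_surjective a
    obtain ⟨N, hN⟩ := h.exists_sum r
    refine ⟨N, ?_⟩
    conv_lhs => rw [hN, map_sum]
    rfl
  mul_mem i j a ha b hb := by
    obtain ⟨r, hr, rfl⟩ := mem_gradedPiece.1 ha
    obtain ⟨s, hs, rfl⟩ := mem_gradedPiece.1 hb
    rw [← map_mul]
    exact mk_mem_gradedPiece (h.mul_mem _ _ _ hr _ hs)
  one_mem := mk_mem_gradedPiece h.one_mem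
  x_mem := mk_mem_gradedPiece h.x_mem
  y_mem := mk_mem_gradedPiece h.y_mem
  exists_zero a ha := by
    obtain ⟨r, hr, rfl⟩ := mem_gradedPiece.1 ha
    obtain ⟨c, rfl⟩ := h.exists_zero r hr
    exact ⟨c, rfl⟩
  exists_succ n a ha := by
    obtain ⟨r, hr, rfl⟩ := mem_gradedPiece.1 ha
    obtain ⟨c, w, hw, rfl⟩ := h.exists_succ n r hr
    exact ⟨c, Ideal.Quotient.mk I w, mk_mem_gradedPiece hw, by
      rw [map_add, map_mul, mk_smul, map_pow]⟩

/-- The Jordan basis, as a family indexed by `Fin t` with lengths given by `rows`. -/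
theorem HasJordanType.exists_basis {I : Ideal (MvPolynomial (Fin 2) K)}
    {ℓ : MvPolynomial (Fin 2) K} {n : ℕ} {P : n.Partition} (h : HasJordanType (mulMap I ℓ) P) :
    ∃ b : Module.Basis (Σ i : Fin P.parts.card, Fin (rows P.parts i)) K
      (MvPolynomial (Fin 2) K ⧸ I),
      IsStringBasis (LinearMap.mulLeft K (Ideal.Quotient.mk I ℓ)) b := h

/-- If a linear form that is zero in `K[x,y]` has a Jordan type with `d` or `d + k - 1` parts,
then the ideal contains a nonzero linear form. -/
theorem exists_linear_mem {d k : ℕ} (hd : 1 ≤ d) (hk : 1 ≤ k) {P : (d * (d + k - 1)).Partition}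
    (hc : P.parts.card = d ∨ P.parts.card = d + k - 1) {I : Ideal (MvPolynomial (Fin 2) K)}
    (h : Realizes d k P I 0) :
    ∃ m : MvPolynomial (Fin 2) K, m.IsHomogeneous 1 ∧ m ≠ 0 ∧ m ∈ I := by
  obtain ⟨-, hH, -, hJ⟩ := h
  obtain ⟨b, hb⟩ := hJ.exists_basis
  -- The zero map has blocks of size one only, so there are `d (d + k - 1)` parts. The bound on
  -- their number forces `d = 1`, and then degree one of the quotient is at most one-dimensional.
  have hrow : ∀ i < P.parts.card, rows P.parts i ≤ 1 := by
    intro i hi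
    by_contra hlt
    push Not at hlt
    have h1 := hb ⟨i, hi⟩ ⟨0, by simp only; omega⟩
    rw [dif_pos (by simpa using hlt), map_zero, LinearMap.mulLeft_zero_eq_zero,
      LinearMap.zero_apply] at h1
    exact b.ne_zero _ h1.symm
  have hsum : d * (d + k - 1) ≤ P.parts.card := by
    refine P.parts_sum.symm.le.trans ?_
    conv_lhs => rw [← map_rows P.parts]
    have : ((Multiset.range P.parts.card).map (rows P.parts)).sum ≤
        ((Multiset.range P.parts.card).map fun _ => 1).sum := by
      refine Multiset.sum_map_le_sum_map _ _ fun i hi => hrow i (Multiset.mem_range.1 hi)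
    simpa using this
  have hd1 : d = 1 := by
    rcases hc with hc | hc
    · rw [hc] at hsum
      have : d + k - 1 ≤ 1 := by
        by_contra hlt
        push Not at hlt
        have := Nat.mul_lt_mul_of_pos_left hlt (by omega : 0 < d)
        omega
      omega
    · rw [hc] at hsum
      by_contra hne
      have : 1 * (d + k - 1) < d * (d + k - 1) :=
        Nat.mul_lt_mul_of_pos_right (by omega) (by omega)
      omega
  have hT : hilbertFunction I 1 ≤ 1 := by
    rw [hH, T, hd1]
    omega
  have : FiniteDimensional K (MvPolynomial (Fin 2) K ⧸ I) := Module.Finite.of_basis b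
  by_contra hno
  push Not at hno
  have hX : ∀ s : Fin 2, Ideal.Quotient.mk I (X s) ∈ gradedPiece I 1 :=
    fun s => mk_mem_gradedPiece (isHomogeneous_X K s)
  have hli : LinearIndependent K (fun s : Fin 2 => (⟨_, hX s⟩ : gradedPiece I 1)) := by
    rw [Fintype.linearIndependent_iff]
    intro c h0
    have h1 : Ideal.Quotient.mk I (c 0 • X 0 + c 1 • X 1) = 0 := by
      have h2 := congrArg Subtype.val h0
      simpa [Fin.sum_univ_two, mk_smul] using h2
    have hhom : (c 0 • X 0 + c 1 • X 1 : MvPolynomial (Fin 2) K).IsHomogeneous 1 :=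
      Submodule.add_mem (homogeneousSubmodule (Fin 2) K 1)
        (Submodule.smul_mem _ _ (isHomogeneous_X K 0))
        (Submodule.smul_mem _ _ (isHomogeneous_X K 1))
    have h3 : (c 0 • X 0 + c 1 • X 1 : MvPolynomial (Fin 2) K) = 0 := by
      by_contra hne
      exact hno _ hhom hne (Ideal.Quotient.eq_zero_iff_mem.1 h1)
    intro s
    have h4 := congrArg (coeff (Finsupp.single s 1)) h3
    fin_cases s <;> simpa [coeff_X, Finsupp.single_left_inj] using h4
  have := hli.fintype_card_le_finrank
  rw [Fintype.card_fin] at this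
  unfold hilbertFunction at hT
  omega

theorem Realizes.exists_planeGrading {d k : ℕ} (hd : 1 ≤ d) (hk : 1 ≤ k)
    {P : (d * (d + k - 1)).Partition} (hc : P.parts.card = d ∨ P.parts.card = d + k - 1)
    {I : Ideal (MvPolynomial (Fin 2) K)} {ℓ : MvPolynomial (Fin 2) K} (h : Realizes d k P I ℓ) :
    ∃ y, PlaneGrading (gradedPiece I) (quotProj h.1.isGradedIdeal) (Ideal.Quotient.mk I ℓ) y ∧
      IsNilpotent (Ideal.Quotient.mk I ℓ) ∧ PlaneGrading.height (Ideal.Quotient.mk I ℓ) y = rows P.parts := by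
  obtain ⟨y, hy⟩ : ∃ y, PlaneGrading (gradedPiece I) (quotProj h.1.isGradedIdeal)
      (Ideal.Quotient.mk I ℓ) y := by
    -- If `ℓ = 0`, its class is also that of a nonzero linear form in `I`, which does have a
    -- complement.
    by_cases h0 : ℓ = 0
    · subst h0
      obtain ⟨m, hm, hm0, hmI⟩ := exists_linear_mem hd hk hc h
      obtain ⟨y, hy, hX⟩ := exists_complement hm hm0
      have := planeGrading_quotient h.1.isGradedIdeal (planeGrading_polynomial hm hy hX)
      rw [Ideal.Quotient.eq_zero_iff_mem.2 hmI, ← map_zero (Ideal.Quotient.mk I)] at this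
      exact ⟨_, this⟩
    · obtain ⟨y, hy, hX⟩ := exists_complement h.2.2.1 h0
      exact ⟨_, planeGrading_quotient h.1.isGradedIdeal
        (planeGrading_polynomial h.2.2.1 hy hX)⟩
  obtain ⟨b, hb⟩ := h.2.2.2.exists_basis
  exact ⟨y, hy, hy.height_eq (rows_antitone _) (fun i hi => rows_of_le hi) b hb⟩

theorem mulMap_pow_apply {I : Ideal (MvPolynomial (Fin 2) K)} {ℓ : MvPolynomial (Fin 2) K} (n : ℕ)
    (a : MvPolynomial (Fin 2) K ⧸ I) :
    (mulMap I ℓ ^ n) a = Ideal.Quotient.mk I ℓ ^ n * a := by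
  rw [mulMap, LinearMap.pow_mulLeft, LinearMap.mulLeft_apply]

theorem Realizes.nonempty_stringDecomposition {d k : ℕ} (hd : 1 ≤ d) (hk : 1 ≤ k)
    {P : (d * (d + k - 1)).Partition} (hc : P.parts.card = d ∨ P.parts.card = d + k - 1)
    {I : Ideal (MvPolynomial (Fin 2) K)} {ℓ : MvPolynomial (Fin 2) K} (h : Realizes d k P I ℓ) :
    Nonempty (StringDecomposition I ℓ) := by
  obtain ⟨y, hy, hx, hh⟩ := h.exists_planeGrading hd hk hc
  obtain ⟨b, -⟩ := h.2.2.2.exists_basis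
  have : FiniteDimensional K (MvPolynomial (Fin 2) K ⧸ I) := Module.Finite.of_basis b
  obtain ⟨t, z, b, ht, hz, hz0, hb⟩ := hy.exists_basis hx
  have hb' : (fun v : (Σ u : Fin t, Fin (PlaneGrading.height (Ideal.Quotient.mk I ℓ) y u)) =>
      ((mulMap I ℓ) ^ (v.2 : ℕ)) (z v.1)) = b := by
    funext v
    rw [mulMap_pow_apply, hb]
  exact ⟨{
    num := t
    deg := fun u => u
    len := fun u => PlaneGrading.height (Ideal.Quotient.mk I ℓ) y u
    gen := fun u => z u
    len_pos := fun u => (ht u).1 u.2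
    gen_mem := fun u => hz.mem u
    pow_len := fun u => by rw [mulMap_pow_apply, hz0]
    linearIndependent := by rw [hb']; exact b.linearIndependent
    span_eq_top := by rw [hb']; exact b.span_eq }⟩

theorem Realizes.stringDecomposition_V {d k : ℕ} (hd : 1 ≤ d) (hk : 1 ≤ k)
    {P : (d * (d + k - 1)).Partition} (hc : P.parts.card = d ∨ P.parts.card = d + k - 1)
    {I : Ideal (MvPolynomial (Fin 2) K)} {ℓ : MvPolynomial (Fin 2) K} (h : Realizes d k P I ℓ)
    (D : StringDecomposition I ℓ) :
    (∀ i s : ℕ, ¬ (i < P.parts.card ∧ s = part P i) → D.V i s = ⊥) ∧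
      ∀ i : ℕ, i < P.parts.card → Module.finrank K (D.V i (part P i)) = 1 := by
  obtain ⟨y, hy, hx, hh⟩ := h.exists_planeGrading hd hk hc
  let b := Module.Basis.mk D.linearIndependent D.span_eq_top.ge
  obtain ⟨hinj, hlen, hex⟩ := hy.strings_unique hx D.len_pos D.gen_mem b
    (fun v => by rw [Module.Basis.mk_apply, mulMap_pow_apply])
    (fun u => by rw [← mulMap_pow_apply, D.pow_len])
  have hpos : ∀ i, 0 < rows P.parts i ↔ i < P.parts.card := by
    intro i
    constructor
    · intro hi
      by_contra hlt
      rw [rows_of_le (by omega)] at hi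
      omega
    · intro hi
      exact P.parts_pos (rows_mem hi)
  rw [hh] at hlen hex
  constructor
  · intro i s his
    rw [StringDecomposition.V, Submodule.span_eq_bot]
    rintro _ ⟨u, rfl, rfl, rfl⟩
    refine absurd ⟨?_, hlen u⟩ his
    rw [← hpos, ← hlen]
    exact D.len_pos u
  · intro i hi
    obtain ⟨u, rfl⟩ := hex i ((hpos i).2 hi)
    have h1 : {z | ∃ v, D.deg v = D.deg u ∧ D.len v = part P (D.deg u) ∧ D.gen v = z} =
        {D.gen u} := by
      ext z
      constructor
      · rintro ⟨v, hv, -, rfl⟩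
        rw [hinj hv]
        rfl
      · rintro rfl
        exact ⟨u, rfl, hlen u, rfl⟩
    rw [StringDecomposition.V, h1, finrank_span_singleton]
    have h2 := D.linearIndependent.ne_zero ⟨u, ⟨0, D.len_pos u⟩⟩
    simpa using h2

end Quotients

/-! ### The complete intersection attached to a shape -/

section Realization

variable {K : Type*} [Field K]

/-- In a factorial ring, if `f` is coprime to `g` and divides `g * r`, then it divides `r`. So `g`
is a nonzerodivisor modulo `f`. -/
theorem isRegular_pair {f g : MvPolynomial (Fin 2) K} (hf : f ≠ 0) (h : IsRelPrime f g)
    (hne : Ideal.span {f, g} ≠ ⊤) :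
    RingTheory.Sequence.IsRegular (MvPolynomial (Fin 2) K) [f, g] := by
  rw [RingTheory.Sequence.isRegular_iff]
  refine ⟨?_, ?_⟩
  · rw [RingTheory.Sequence.isWeaklyRegular_cons_iff,
      RingTheory.Sequence.isWeaklyRegular_singleton_iff]
    refine ⟨?_, ?_⟩
    · rw [isSMulRegular_iff_right_eq_zero_of_smul]
      intro r hr
      exact (mul_eq_zero.1 hr).resolve_left hf
    · rw [isSMulRegular_on_quot_iff_lsmul_comap_le]
      intro r hr
      rw [Submodule.mem_comap, LinearMap.lsmul_apply, Submodule.mem_smul_pointwise_iff_exists] at hr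
      obtain ⟨s, -, hs⟩ := hr
      rw [smul_eq_mul, smul_eq_mul] at hs
      obtain ⟨q, rfl⟩ := h.dvd_of_dvd_mul_left (Dvd.intro s hs)
      rw [← smul_eq_mul]
      exact Submodule.smul_mem_pointwise_smul _ _ _ trivial
  · rw [Ideal.smul_eq_mul, Ideal.mul_top]
    intro h
    apply hne
    rw [h]
    simp [Ideal.ofList_cons, Ideal.span_insert]

theorem prime_X_zero : Prime (X 0 : MvPolynomial (Fin 2) K) := by
  refine ⟨X_ne_zero 0, ?_, fun a b h => X_dvd_mul_iff.1 h⟩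
  intro h
  have := h.map (eval (0 : Fin 2 → K))
  simp at this

theorem not_X_dvd_of_sub {r : MvPolynomial (Fin 2) K} {i : ℕ} (h : X 0 ∣ r - X 1 ^ i) :
    ¬ X 0 ∣ r := by
  intro h1
  have h2 := (dvd_sub_right h1).1 h
  have h3 := map_dvd (eval (![0, 1] : Fin 2 → K)) h2
  simp at h3

theorem not_pow_dvd (i a : ℕ) :
    ¬ (X 0 : MvPolynomial (Fin 2) K) ^ (a + 1) ∣ X 0 ^ a * X 1 ^ i := by
  rw [pow_succ, mul_dvd_mul_iff_left (pow_ne_zero _ (X_ne_zero 0))]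
  exact not_X_dvd_of_sub (i := i) (by rw [sub_self]; exact dvd_zero _)

/-- The generators of the strings of length `p i`: `y` times such a generator is the next one, up
to a multiple of an earlier generator whose string stops one degree later. -/
noncomputable def stringGen (K : Type*) [Field K] (t : ℕ) (p : ℕ → ℕ) :
    ℕ → MvPolynomial (Fin 2) K
  | 0 => 1
  | i + 1 => X 1 * stringGen K t p i - ∑ b : Fin (i + 1),
      if i < t ∧ (b : ℕ) + p b = i + p i + 1 then X 0 ^ (i + 1 - b) * stringGen K t p b else 0
termination_by i => i
decreasing_by all_goals omega

theorem stringGen_zero (t : ℕ) (p : ℕ → ℕ) : stringGen K t p 0 = 1 := by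
  rw [stringGen]

theorem stringGen_succ (t : ℕ) (p : ℕ → ℕ) (i : ℕ) : stringGen K t p (i + 1) =
    X 1 * stringGen K t p i - ∑ b : Fin (i + 1),
      if i < t ∧ (b : ℕ) + p b = i + p i + 1 then X 0 ^ (i + 1 - b) * stringGen K t p b
      else 0 := by
  rw [stringGen]

theorem monic_stringGen (t : ℕ) (p : ℕ → ℕ) :
    PlaneGrading.Monic (homogeneousSubmodule (Fin 2) K) (X 0) (X 1) (stringGen K t p) := by
  constructor
  · intro i
    induction i using Nat.strong_induction_on with
    | _ i ih =>
      rcases i with _ | i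
      · rw [stringGen_zero]
        exact isHomogeneous_one _ _
      · rw [stringGen_succ]
        refine Submodule.sub_mem _ ?_ (Submodule.sum_mem _ fun b _ => ?_)
        · have := planeGrading_X.mul_mem _ _ _ (isHomogeneous_X K 1) _ (ih i (by omega))
          rwa [add_comm 1 i] at this
        · split_ifs
          · have := planeGrading_X.mul_mem _ _ _ ((isHomogeneous_X K 0).pow (i + 1 - b)) _
              (ih b b.2)
            rwa [one_mul, Nat.sub_add_cancel b.2.le] at this
          · exact Submodule.zero_mem _
  · intro i
    induction i with
    | zero => simp [stringGen_zero]
    | succ i ih =>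
      rw [stringGen_succ, sub_right_comm, pow_succ', ← mul_sub]
      refine dvd_sub (ih.mul_left _) (Finset.dvd_sum fun b _ => ?_)
      split_ifs
      · exact (dvd_pow_self _ (by omega)).mul_right _
      · exact dvd_zero _

variable {t t' : ℕ} {p : ℕ → ℕ}

theorem stringGen_succ_of_le (h : Shape t t' p) {i b : ℕ} (hi : i < t) (hb : b ≤ i)
    (e : b + p b = i + p i + 1) : stringGen K t p (i + 1) =
      X 1 * stringGen K t p i - X 0 ^ (i + 1 - b) * stringGen K t p b := by
  rw [stringGen_succ, Finset.sum_eq_single (⟨b, by omega⟩ : Fin (i + 1))]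
  · rw [if_pos ⟨hi, e⟩]
  · intro b' _ hne
    rw [if_neg]
    rintro ⟨-, e'⟩
    exact hne (Fin.ext (h.inj b' (by omega) b (by omega) (by omega)))
  · intro hn
    exact absurd (Finset.mem_univ _) hn

theorem stringGen_succ_of_forall {i : ℕ} (hi : i < t → ∀ b ≤ i, b + p b ≠ i + p i + 1) :
    stringGen K t p (i + 1) = X 1 * stringGen K t p i := by
  rw [stringGen_succ, Finset.sum_eq_zero, sub_zero]
  intro b _
  rw [if_neg]
  rintro ⟨h1, h2⟩
  exact hi h1 b (by omega) h2

/-- The ideal generated by `z t` and `x ^ p i * z i`, where `z = stringGen K t p`. -/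
noncomputable def shapeIdeal (K : Type*) [Field K] (t : ℕ) (p : ℕ → ℕ) (i : ℕ) :
    Ideal (MvPolynomial (Fin 2) K) :=
  Ideal.span {stringGen K t p t, X 0 ^ p i * stringGen K t p i}

/-- The `K`-span of the elements `x ^ a * z i` with `p i ≤ a`. -/
noncomputable def shapeSpan (K : Type*) [Field K] (t : ℕ) (p : ℕ → ℕ) :
    Submodule K (MvPolynomial (Fin 2) K) :=
  Submodule.span K ((fun v : ℕ × ℕ => X 0 ^ v.2 * stringGen K t p v.1) '' {v | p v.1 ≤ v.2})

theorem mem_shapeSpan {i a : ℕ} (h : p i ≤ a) :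
    X 0 ^ a * stringGen K t p i ∈ shapeSpan K t p :=
  Submodule.subset_span ⟨(i, a), h, rfl⟩

theorem stringGen_mem_shapeSpan (h : Shape t t' p) {i : ℕ} (hi : t ≤ i) :
    stringGen K t p i ∈ shapeSpan K t p := by
  have := mem_shapeSpan (K := K) (t := t) (h.zero i hi).le
  rwa [pow_zero, one_mul] at this

/-- The recursion gives `y * x ^ a * z i = x ^ a * z (i + 1) + x ^ (a + i + 1 - b) * z b`. From `a ≥
p i` follows `a + i + 1 - b ≥ p b`, because row `b` stops exactly one diagonal after row `i`. -/
theorem X_mul_mem_shapeSpan (h : Shape t t' p) (s : Fin 2) {r : MvPolynomial (Fin 2) K}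
    (hr : r ∈ shapeSpan K t p) : X s * r ∈ shapeSpan K t p := by
  have hle : shapeSpan K t p ≤ (shapeSpan K t p).comap (LinearMap.mulLeft K (X s)) := by
    conv_lhs => rw [shapeSpan]
    rw [Submodule.span_le]
    rintro _ ⟨⟨i, a⟩, hv, rfl⟩
    have hv' : p i ≤ a := hv
    rw [SetLike.mem_coe, Submodule.mem_comap, LinearMap.mulLeft_apply]
    dsimp only
    have h1 : p (i + 1) ≤ p i := h.anti (Nat.le_succ i)
    have hs : s = 0 ∨ s = 1 := by omega
    rcases hs with rfl | rfl
    · rw [← mul_assoc, ← pow_succ']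
      exact mem_shapeSpan (by omega)
    · rw [mul_left_comm]
      by_cases hb : i < t ∧ ∃ b ≤ i, b + p b = i + p i + 1
      · obtain ⟨hi, b, hb, e⟩ := hb
        have h2 : X 1 * stringGen K t p i =
            stringGen K t p (i + 1) + X 0 ^ (i + 1 - b) * stringGen K t p b := by
          rw [stringGen_succ_of_le h hi hb e]; ring
        rw [h2, mul_add, ← mul_assoc, ← pow_add]
        exact Submodule.add_mem _ (mem_shapeSpan (by omega)) (mem_shapeSpan (by omega))
      · push Not at hb
        rw [← stringGen_succ_of_forall hb]
        exact mem_shapeSpan (by omega)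
  exact hle hr

theorem mul_mem_shapeSpan (h : Shape t t' p) (q : MvPolynomial (Fin 2) K)
    {r : MvPolynomial (Fin 2) K} (hr : r ∈ shapeSpan K t p) : q * r ∈ shapeSpan K t p := by
  induction q using MvPolynomial.induction_on with
  | C a =>
    rw [C_mul']
    exact Submodule.smul_mem _ _ hr
  | add p q hp hq =>
    rw [add_mul]
    exact Submodule.add_mem _ hp hq
  | mul_X q s hq =>
    rw [mul_right_comm, mul_comm]
    exact X_mul_mem_shapeSpan h s hq

/-- Induction on the degree `i + p i`, starting from `t'` at row `m`. If row `u` stops one diagonal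
before row `i`, then `x ^ p i * z i` is `y * x ^ p u * z u` when `i = u + 1`, and otherwise this
minus `x ^ p u * z (u + 1)`. The subtracted term is a multiple of `z t` or of a relation of smaller
degree. -/
theorem pow_mul_stringGen_mem (h : Shape t t' p) {m : ℕ} (hm : m < t) (hmt : m + p m = t') :
    ∀ i, X 0 ^ p i * stringGen K t p i ∈ shapeIdeal K t p m := by
  have hf : stringGen K t p t ∈ shapeIdeal K t p m := Ideal.subset_span (Or.inl rfl)
  have hg : X 0 ^ p m * stringGen K t p m ∈ shapeIdeal K t p m := Ideal.subset_span (Or.inr rfl)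
  have key : ∀ n i, i < t → i + p i = n → X 0 ^ p i * stringGen K t p i ∈ shapeIdeal K t p m := by
    intro n
    induction n using Nat.strong_induction_on with
    | _ n ih =>
      intro i hi hn
      by_cases him : i = m
      · rwa [him]
      have h1 := h.lb i hi
      have h2 : i + p i ≠ m + p m := fun e => him (h.inj i hi m hm e)
      obtain ⟨u, hu, hue⟩ := h.exists_index (by omega : t' ≤ n - 1) (by
        have := h.ub i hi
        omega)
      have h3 := ih (n - 1) (by omega) u hu hue
      have h4 := h.le_succ_of_eq_succ hu hi (by omega)
      rcases (by omega : i = u + 1 ∨ i ≤ u) with rfl | hiu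
      · rw [stringGen_succ_of_forall, mul_left_comm, show p (u + 1) = p u by omega]
        · exact Ideal.mul_mem_left _ _ h3
        · intro _ b hb e
          have := h.inj b (by omega) (u + 1) hi (by omega)
          omega
      · have h5 := stringGen_succ_of_le (K := K) h hu hiu (by omega)
        have h6 : X 0 ^ p i * stringGen K t p i =
            X 1 * (X 0 ^ p u * stringGen K t p u) - X 0 ^ p u * stringGen K t p (u + 1) := by
          rw [h5, show p i = p u + (u + 1 - i) by omega, pow_add]
          ring
        rw [h6]
        refine Ideal.sub_mem _ (Ideal.mul_mem_left _ _ h3) ?_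
        have h7 : p (u + 1) ≤ p u := h.anti (Nat.le_succ u)
        rcases (by omega : u + 1 = t ∨ u + 1 < t) with h8 | h8
        · rw [h8]
          exact Ideal.mul_mem_left _ _ hf
        · rw [show p u = (p u - p (u + 1)) + p (u + 1) by omega, pow_add, mul_assoc]
          refine Ideal.mul_mem_left _ _ (ih _ ?_ (u + 1) h8 rfl)
          -- Row `u + 1` stops no later than row `i`; being a different row, it stops strictly
          -- earlier.
          have h9 : u + 1 + p (u + 1) ≠ i + p i := fun e => by
            have := h.inj (u + 1) h8 i hi e
            omega
          omega
  intro i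
  rcases lt_or_ge i t with hi | hi
  · exact key _ i hi rfl
  · refine Ideal.mul_mem_left _ _ ?_
    induction i, hi using Nat.le_induction with
    | base => exact hf
    | succ i hi ih =>
      rw [stringGen_succ_of_forall (by omega)]
      exact Ideal.mul_mem_left _ _ ih

theorem shapeIdeal_eq (h : Shape t t' p) {m : ℕ} (hm : m < t) (hmt : m + p m = t') :
    (shapeIdeal K t p m).restrictScalars K = shapeSpan K t p := by
  apply le_antisymm
  · intro r hr
    obtain ⟨a, b, rfl⟩ := Ideal.mem_span_pair.1 ((Submodule.restrictScalars_mem K _ r).1 hr)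
    exact Submodule.add_mem _ (mul_mem_shapeSpan h _ (stringGen_mem_shapeSpan h le_rfl))
      (mul_mem_shapeSpan h _ (mem_shapeSpan le_rfl))
  · rw [shapeSpan, Submodule.span_le]
    rintro _ ⟨⟨i, a⟩, hv, rfl⟩
    have hv' : p i ≤ a := hv
    refine (Submodule.restrictScalars_mem K _ _).2 ?_
    dsimp only
    rw [show a = (a - p i) + p i by omega, pow_add, mul_assoc]
    exact Ideal.mul_mem_left _ _ (pow_mul_stringGen_mem h hm hmt i)

/-- As `z 0 = 1`, the ideal contains `x ^ p 0`, so a common factor of the generators divides a power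
of `x`. But `x` does not divide `z t`, which is `y ^ t` modulo `x`. -/
theorem isGradedCI_shapeIdeal (h : Shape t t' p) {m : ℕ} (hm : m < t) (hmt : m + p m = t')
    (ht' : 0 < t') : IsGradedCI (shapeIdeal K t p m) := by
  have hz := monic_stringGen (K := K) t p
  have hhom : (X 0 ^ p m * stringGen K t p m).IsHomogeneous t' := by
    have := ((isHomogeneous_X K (0 : Fin 2)).pow (p m)).mul (hz.mem m)
    rwa [one_mul, add_comm, hmt] at this
  have hnd := not_X_dvd_of_sub (hz.dvd t)
  refine ⟨_, _, t, t', hz.mem t, hhom, isRegular_pair ?_ ?_ ?_, rfl⟩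
  · intro h0
    rw [h0] at hnd
    exact hnd (dvd_zero _)
  · have h1 : IsRelPrime (stringGen K t p t) (X 0 ^ p 0) :=
      ((prime_X_zero.irreducible.isRelPrime_iff_not_dvd).2 hnd).symm.pow_right
    intro c hc1 hc2
    refine h1 hc1 ?_
    have h2 := pow_mul_stringGen_mem (K := K) h hm hmt 0
    rw [stringGen_zero, mul_one] at h2
    obtain ⟨a, b, e⟩ := Ideal.mem_span_pair.1 h2
    rw [← e]
    exact dvd_add (hc1.mul_left a) (hc2.mul_left b)
  · rw [ne_eq, Ideal.eq_top_iff_one]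
    intro h1
    obtain ⟨a, b, e⟩ := Ideal.mem_span_pair.1 h1
    have h2 := congrArg (eval (0 : Fin 2 → K)) e
    have h3 : ∀ (q : MvPolynomial (Fin 2) K) (n : ℕ), 0 < n → q.IsHomogeneous n →
        eval (0 : Fin 2 → K) q = 0 := by
      intro q n hn hq
      rw [eval_zero, constantCoeff_eq]
      exact hq.coeff_eq_zero (by simp; omega)
    rw [map_add, map_mul, map_mul, h3 _ t (by omega) (hz.mem t), h3 _ t' ht' hhom] at h2
    simp at h2

end Realization

/-- The kernel of `φ` is spanned by the last vectors of the strings: a coordinate of `c` before the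
end of a string reappears, shifted by one place, in `φ c`. -/
theorem IsStringBasis.succ_eq_of_repr_ne_zero {K V ι : Type*} [Field K] [AddCommGroup V]
    [Module K V] {φ : Module.End K V} {len : ι → ℕ} {b : Module.Basis (Σ i, Fin (len i)) K V}
    (hb : IsStringBasis φ b) {c : V} (hc : φ c = 0) {v : Σ i, Fin (len i)}
    (hv : b.repr c v ≠ 0) : (v.2 : ℕ) + 1 = len v.1 := by
  classical
  obtain ⟨i, s⟩ := v
  by_contra hne
  have hs : (s : ℕ) + 1 < len i := by
    have := s.2
    dsimp only at hne
    omega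
  have h1 : b.coord ⟨i, ⟨s + 1, hs⟩⟩ ∘ₗ φ = b.coord ⟨i, s⟩ := by
    refine b.ext ?_
    rintro ⟨i', s'⟩
    rw [LinearMap.comp_apply, hb, b.coord_apply, b.coord_apply, b.repr_self,
      Finsupp.single_apply]
    split_ifs with h2 h3 h3
    · rw [b.repr_self]
      obtain ⟨rfl, h4⟩ := Sigma.mk.inj_iff.1 h3
      rw [heq_eq_eq] at h4
      subst h4
      exact Finsupp.single_eq_same
    · rw [b.repr_self, Finsupp.single_apply, if_neg]
      intro e
      obtain ⟨rfl, h4⟩ := Sigma.mk.inj_iff.1 e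
      rw [heq_eq_eq, Fin.mk.injEq] at h4
      exact h3 (by rw [Fin.ext (by omega : (s' : ℕ) = s)])
    · obtain ⟨rfl, h4⟩ := Sigma.mk.inj_iff.1 h3
      rw [heq_eq_eq] at h4
      subst h4
      exact absurd hs h2
    · rw [map_zero, Finsupp.zero_apply]
  have h2 := LinearMap.congr_fun h1 c
  rw [LinearMap.comp_apply, hc, map_zero, b.coord_apply] at h2
  exact hv h2.symm

/-! ### String basis, Hilbert function and socle of the quotient -/

section RealizationBasis

variable {K : Type*} [Field K] {t t' : ℕ} {p : ℕ → ℕ} {m : ℕ}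

theorem pow_mul_mk_stringGen (h : Shape t t' p) (hm : m < t) (hmt : m + p m = t') {i a : ℕ}
    (ha : p i ≤ a) : Ideal.Quotient.mk (shapeIdeal K t p m) (X 0) ^ a *
      Ideal.Quotient.mk (shapeIdeal K t p m) (stringGen K t p i) = 0 := by
  rw [← map_pow, ← map_mul, Ideal.Quotient.eq_zero_iff_mem, show a = (a - p i) + p i by omega,
    pow_add, mul_assoc]
  exact Ideal.mul_mem_left _ _ (pow_mul_stringGen_mem h hm hmt i)

/-- All products `x ^ a * z i` are independent in the polynomial ring, and the ideal is the span of
those with `p i ≤ a`. The others therefore stay independent modulo it. -/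
theorem linearIndependent_quotient (h : Shape t t' p) (hm : m < t) (hmt : m + p m = t') :
    LinearIndependent K (fun v : Σ i : Fin t, Fin (p i) =>
      Ideal.Quotient.mk (shapeIdeal K t p m) (X 0) ^ (v.2 : ℕ) *
        Ideal.Quotient.mk (shapeIdeal K t p m) (stringGen K t p v.1)) := by
  have hli : LinearIndependent K (fun v : ℕ × ℕ => X 0 ^ v.2 * stringGen K t p v.1) := by
    rw [← linearIndepOn_univ_iff]
    exact (monic_stringGen t p).linearIndepOn planeGrading_X (fun v _ => not_pow_dvd v.1 v.2)
  have hinj : Function.Injective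
      (fun v : Σ i : Fin t, Fin (p i) => (((v.1 : ℕ), (v.2 : ℕ)) : ℕ × ℕ)) := by
    rintro ⟨⟨i, hi⟩, ⟨s, hs⟩⟩ ⟨⟨i', hi'⟩, ⟨s', hs'⟩⟩ e
    simp only [Prod.mk.injEq] at e
    obtain ⟨rfl, rfl⟩ := e
    rfl
  have h2 := hli.comp _ hinj
  have hdisj : Disjoint {v : ℕ × ℕ | v.2 < p v.1} {v | p v.1 ≤ v.2} := by
    rw [Set.disjoint_left]
    intro v hv hv'
    rw [Set.mem_ofPred_eq] at hv hv'
    omega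
  refine (h2.map (f := (Ideal.Quotient.mkₐ K (shapeIdeal K t p m)).toLinearMap) ?_ :)
  refine (hli.disjoint_span_image hdisj).mono ?_ ?_
  · refine Submodule.span_mono ?_
    rintro _ ⟨v, rfl⟩
    exact ⟨((v.1 : ℕ), (v.2 : ℕ)), v.2.2, rfl⟩
  · intro r hr
    have h3 : r ∈ (shapeIdeal K t p m).restrictScalars K :=
      Ideal.Quotient.eq_zero_iff_mem.1 hr
    rwa [shapeIdeal_eq h hm hmt] at h3

theorem isGradedIdeal_shapeIdeal (h : Shape t t' p) (hm : m < t) (hmt : m + p m = t')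
    (ht' : 0 < t') : IsGradedIdeal (shapeIdeal K t p m) :=
  (isGradedCI_shapeIdeal h hm hmt ht').isGradedIdeal

theorem monic_mk_stringGen : PlaneGrading.Monic (gradedPiece (shapeIdeal K t p m))
    (Ideal.Quotient.mk (shapeIdeal K t p m) (X 0)) (Ideal.Quotient.mk (shapeIdeal K t p m) (X 1))
    (fun i => Ideal.Quotient.mk (shapeIdeal K t p m) (stringGen K t p i)) where
  mem i := mk_mem_gradedPiece ((monic_stringGen t p).mem i)
  dvd i := by
    rw [← map_pow, ← map_sub]
    exact map_dvd _ ((monic_stringGen t p).dvd i)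

/-- The basis of the quotient by `shapeIdeal` that consists of the strings. -/
noncomputable def shapeBasis (h : Shape t t' p) (hm : m < t) (hmt : m + p m = t') (ht' : 0 < t') :
    Module.Basis (Σ i : Fin t, Fin (p i)) K (MvPolynomial (Fin 2) K ⧸ shapeIdeal K t p m) :=
  Module.Basis.mk (linearIndependent_quotient h hm hmt)
    (monic_mk_stringGen.span_eq_top
      (planeGrading_quotient (isGradedIdeal_shapeIdeal h hm hmt ht') planeGrading_X)
      (fun _ => pow_mul_mk_stringGen h hm hmt le_rfl) h.zero).ge

theorem shapeBasis_apply (h : Shape t t' p) (hm : m < t) (hmt : m + p m = t') (ht' : 0 < t')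
    (v : Σ i : Fin t, Fin (p i)) : shapeBasis (K := K) h hm hmt ht' v =
      Ideal.Quotient.mk (shapeIdeal K t p m) (X 0) ^ (v.2 : ℕ) *
        Ideal.Quotient.mk (shapeIdeal K t p m) (stringGen K t p v.1) := by
  rw [shapeBasis, Module.Basis.mk_apply]

theorem isStringBasis_shapeBasis (h : Shape t t' p) (hm : m < t) (hmt : m + p m = t')
    (ht' : 0 < t') : IsStringBasis
      (LinearMap.mulLeft K (Ideal.Quotient.mk (shapeIdeal K t p m) (X 0)))
      (shapeBasis (K := K) h hm hmt ht') :=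
  PlaneGrading.isStringBasis_of_pow
    (g := fun i : Fin t => Ideal.Quotient.mk (shapeIdeal K t p m) (stringGen K t p i))
    (shapeBasis_apply h hm hmt ht')
    (fun _ => pow_mul_mk_stringGen h hm hmt le_rfl)

theorem gradedPiece_shapeIdeal (h : Shape t t' p) (hm : m < t) (hmt : m + p m = t')
    (ht' : 0 < t') (n : ℕ) : gradedPiece (shapeIdeal K t p m) n =
      Submodule.span K (shapeBasis (K := K) h hm hmt ht' '' {v | (v.1 : ℕ) + v.2 = n}) := by
  have hpg := planeGrading_quotient (isGradedIdeal_shapeIdeal (K := K) h hm hmt ht')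
    planeGrading_X
  apply le_antisymm
  · intro a ha
    have := monic_mk_stringGen.mem_span hpg
      (fun _ => pow_mul_mk_stringGen h hm hmt le_rfl) h.zero ha
    rwa [← funext (shapeBasis_apply (K := K) h hm hmt ht')] at this
  · rw [Submodule.span_le]
    rintro _ ⟨v, rfl, rfl⟩
    rw [shapeBasis_apply, SetLike.mem_coe, add_comm]
    exact hpg.mul_mem _ _ _ (hpg.pow_mem hpg.x_mem _) _ (monic_mk_stringGen.mem _)

theorem hilbertFunction_shapeIdeal (h : Shape t t' p) (hm : m < t) (hmt : m + p m = t')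
    (ht' : 0 < t') (n : ℕ) : hilbertFunction (shapeIdeal K t p m) n =
      ((Finset.range (n + 1)).filter fun r => n - r < p r).card := by
  classical
  rw [hilbertFunction, gradedPiece_shapeIdeal h hm hmt ht', Set.image_eq_range]
  refine (finrank_span_eq_card
    ((shapeBasis h hm hmt ht').linearIndependent.comp _ Subtype.val_injective)).trans ?_
  rw [Fintype.card_subtype]
  refine Finset.card_bij (fun v _ => (v.1 : ℕ)) ?_ ?_ ?_
  · rintro ⟨i, s⟩ hv
    rw [Finset.mem_filter, Set.mem_ofPred_eq] at hv
    have h1 := hv.2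
    have h2 := s.2
    rw [Finset.mem_filter, Finset.mem_range]
    dsimp only at h1 h2 ⊢
    omega
  · rintro ⟨⟨i, hi⟩, ⟨s, hs⟩⟩ hv ⟨⟨i', hi'⟩, ⟨s', hs'⟩⟩ hv' e
    rw [Finset.mem_filter, Set.mem_ofPred_eq] at hv hv'
    have h1 := hv.2
    have h2 := hv'.2
    dsimp only at h1 h2 e
    subst e
    obtain rfl : s = s' := by omega
    rfl
  · intro r hr
    rw [Finset.mem_filter, Finset.mem_range] at hr
    have hrt : r < t := by
      by_contra hc
      rw [h.zero r (by omega)] at hr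
      omega
    refine ⟨⟨⟨r, hrt⟩, ⟨n - r, hr.2⟩⟩, ?_, rfl⟩
    rw [Finset.mem_filter, Set.mem_ofPred_eq]
    exact ⟨Finset.mem_univ _, by dsimp only; omega⟩

/-- This controls the term with `z (i + 1)` in `y` times the last vector of string `i`: it vanishes
unless the next row has the same length. -/
theorem X_one_mul_top (h : Shape t t' p) (hm : m < t) (hmt : m + p m = t') {i : ℕ} (hi : i < t) :
    Ideal.Quotient.mk (shapeIdeal K t p m) (X 0) ^ (p i - 1) *
      Ideal.Quotient.mk (shapeIdeal K t p m) (stringGen K t p (i + 1)) = 0 ∨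
    i + 1 < t ∧ p (i + 1) = p i := by
  have h1 : p (i + 1) ≤ p i := h.anti (Nat.le_succ i)
  have h2 := h.pos i hi
  have h3 := h.zero (i + 1)
  by_cases h4 : p (i + 1) = p i
  · exact Or.inr ⟨by omega, h4⟩
  · exact Or.inl (pow_mul_mk_stringGen h hm hmt (by omega))

/-- Multiplication by `y` maps the last vector of a string to the last vector of the string that
stops one degree later, and it annihilates the last vector of the string that stops latest. -/
theorem X_one_mul_last (h : Shape t t' p) (hm : m < t) (hmt : m + p m = t') {i : ℕ} (hi : i < t) :
    (∀ b < t, b + p b = i + p i + 1 →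
      Ideal.Quotient.mk (shapeIdeal K t p m) (X 1) *
        (Ideal.Quotient.mk (shapeIdeal K t p m) (X 0) ^ (p i - 1) *
        Ideal.Quotient.mk (shapeIdeal K t p m) (stringGen K t p i)) =
        Ideal.Quotient.mk (shapeIdeal K t p m) (X 0) ^ (p b - 1) *
        Ideal.Quotient.mk (shapeIdeal K t p m) (stringGen K t p b)) ∧
    (t + t' ≤ i + p i + 1 → Ideal.Quotient.mk (shapeIdeal K t p m) (X 1) *
        (Ideal.Quotient.mk (shapeIdeal K t p m) (X 0) ^ (p i - 1) *
        Ideal.Quotient.mk (shapeIdeal K t p m) (stringGen K t p i)) = 0) := by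
  have h0 := X_one_mul_top (K := K) h hm hmt hi
  have hpi := h.pos i hi
  constructor
  · intro b hb e
    rcases (by have := h.le_succ_of_eq_succ hi hb e; omega : b = i + 1 ∨ b ≤ i) with rfl | hbi
    · rw [mul_left_comm, ← map_mul (Ideal.Quotient.mk _) (X 1), ← stringGen_succ_of_forall,
        show p (i + 1) = p i by omega]
      intro _ b hb' e'
      have := h.inj b (by omega) (i + 1) hb (by omega)
      omega
    · have h1 : X 1 * stringGen K t p i =
          stringGen K t p (i + 1) + X 0 ^ (i + 1 - b) * stringGen K t p b := by
        rw [stringGen_succ_of_le h hi hbi e]; ring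
      rw [mul_left_comm, ← map_mul (Ideal.Quotient.mk _) (X 1), h1, map_add, mul_add, map_mul,
        map_pow, ← mul_assoc, ← pow_add, show p i - 1 + (i + 1 - b) = p b - 1 by omega]
      rcases h0 with h0 | ⟨h2, h3⟩
      · rw [h0, zero_add]
      · have := h.inj b hb (i + 1) h2 (by omega)
        omega
  · intro hle
    rw [mul_left_comm, ← map_mul (Ideal.Quotient.mk _) (X 1), ← stringGen_succ_of_forall]
    · rcases h0 with h0 | ⟨h2, h3⟩
      · exact h0
      · have := h.ub (i + 1) h2
        omega
    · intro _ b hb e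
      have := h.ub b (by omega)
      omega

/-- The last vectors form a single chain under `y`, ordered by the diagonals `i + p i`, which fill
an interval. A power of `y` moves along the chain and finally off its end. -/
theorem X_one_pow_mul_last (h : Shape t t' p) (hm : m < t) (hmt : m + p m = t') (n : ℕ) :
    ∀ i < t, (∀ b < t, b + p b = i + p i + n →
      Ideal.Quotient.mk (shapeIdeal K t p m) (X 1) ^ n *
        (Ideal.Quotient.mk (shapeIdeal K t p m) (X 0) ^ (p i - 1) *
        Ideal.Quotient.mk (shapeIdeal K t p m) (stringGen K t p i)) =
        Ideal.Quotient.mk (shapeIdeal K t p m) (X 0) ^ (p b - 1) *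
        Ideal.Quotient.mk (shapeIdeal K t p m) (stringGen K t p b)) ∧
    (t + t' ≤ i + p i + n → Ideal.Quotient.mk (shapeIdeal K t p m) (X 1) ^ n *
        (Ideal.Quotient.mk (shapeIdeal K t p m) (X 0) ^ (p i - 1) *
        Ideal.Quotient.mk (shapeIdeal K t p m) (stringGen K t p i)) = 0) := by
  induction n with
  | zero =>
    intro i hi
    constructor
    · intro b hb e
      rw [h.inj b hb i hi (by omega), pow_zero, one_mul]
    · intro hle
      have := h.ub i hi
      omega
  | succ n ih =>
    intro i hi
    obtain ⟨h1, h2⟩ := X_one_mul_last (K := K) h hm hmt hi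
    rw [pow_succ, mul_assoc]
    rcases lt_or_ge (i + p i + 1) (t + t') with hlt | hge
    · have := h.lb i hi
      obtain ⟨u, hu, hue⟩ := h.exists_index (by omega : t' ≤ i + p i + 1) hlt
      rw [h1 u hu hue]
      constructor
      · intro b hb e
        exact (ih u hu).1 b hb (by omega)
      · intro hle
        exact (ih u hu).2 (by omega)
    · rw [h2 hge, mul_zero]
      refine ⟨?_, fun _ => rfl⟩
      intro b hb e
      have := h.ub b hb
      omega

/-- A linear functional on `K[x,y]` that is concentrated in degree `t + t' - 2` and whose largest
ideal in the kernel is `shapeIdeal`. -/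
theorem exists_functional (h : Shape t t' p) (hm : m < t) (hmt : m + p m = t') (ht' : 0 < t') :
    ∃ ψ : MvPolynomial (Fin 2) K →ₗ[K] K,
      (∀ r, r ∈ shapeIdeal K t p m ↔ ∀ s, ψ (r * s) = 0) ∧
      ∀ (n : ℕ) (r : MvPolynomial (Fin 2) K), r.IsHomogeneous n → n ≠ t + t' - 2 → ψ r = 0 := by
  -- The functional is the coordinate at the last vector of the string that stops latest, the end of
  -- the chain under `y`.
  obtain ⟨w, hw, hwe⟩ := h.exists_index (by omega : t' ≤ t + t' - 1) (by omega)
  have hpw := h.pos w hw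
  set b := shapeBasis (K := K) h hm hmt ht' with hb
  have hsb : IsStringBasis _ b := isStringBasis_shapeBasis h hm hmt ht'
  set v₀ : Σ i : Fin t, Fin (p i) := ⟨⟨w, hw⟩, ⟨p w - 1, by dsimp only; omega⟩⟩ with hv₀
  refine ⟨b.coord v₀ ∘ₗ (Ideal.Quotient.mkₐ K (shapeIdeal K t p m)).toLinearMap, ?_, ?_⟩
  · intro r
    constructor
    · intro hr s
      have : Ideal.Quotient.mk (shapeIdeal K t p m) (r * s) = 0 :=
        Ideal.Quotient.eq_zero_iff_mem.2 (Ideal.mul_mem_right _ _ hr)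
      change b.coord v₀ (Ideal.Quotient.mk (shapeIdeal K t p m) (r * s)) = 0
      rw [this, map_zero]
    · intro hr
      by_contra hrI
      set x := Ideal.Quotient.mk (shapeIdeal K t p m) (X 0) with hx
      set a := Ideal.Quotient.mk (shapeIdeal K t p m) r with ha
      have ha0 : a ≠ 0 := fun e => hrI (Ideal.Quotient.eq_zero_iff_mem.1 e)
      have hex : ∃ N, x ^ N * a = 0 := by
        refine ⟨p 0, ?_⟩
        have := pow_mul_mk_stringGen (K := K) h hm hmt (le_refl (p 0))
        rw [stringGen_zero, map_one, mul_one] at this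
        rw [hx, this, zero_mul]
      classical
      have hN : 0 < Nat.find hex := by
        rw [Nat.find_pos, pow_zero, one_mul]
        exact ha0
      -- The last nonzero multiple of `a` by a power of `x` is a combination of last vectors.
      set c := x ^ (Nat.find hex - 1) * a with hc
      have hc0 : c ≠ 0 := Nat.find_min hex (by omega)
      have hxc : x * c = 0 := by
        rw [hc, ← mul_assoc, ← pow_succ', Nat.sub_add_cancel hN]
        exact Nat.find_spec hex
      have hcoord : ∀ v, b.repr c v ≠ 0 → (v.2 : ℕ) + 1 = p v.1 := fun v hv =>
        hsb.succ_eq_of_repr_ne_zero hxc hv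
      have hrepr : b.repr c ≠ 0 := fun e => hc0 (b.repr.map_eq_zero_iff.1 e)
      obtain ⟨v, hv, hmin⟩ := (b.repr c).support.exists_min_image
        (fun v => (v.1 : ℕ) + p v.1) (Finsupp.support_nonempty_iff.2 hrepr)
      -- Among the last vectors in `c`, the one at `v` stops first. The power `y ^ n` carries it to
      -- the end of the chain and annihilates all the others.
      set n := t + t' - 1 - ((v.1 : ℕ) + p v.1) with hn
      have hvub := h.ub v.1 v.1.2
      have hval : b.repr (Ideal.Quotient.mk (shapeIdeal K t p m) (X 1) ^ n * c) v₀ =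
          b.repr c v := by
        have h1 : c = ∑ u ∈ (b.repr c).support, b.repr c u • b u := by
          conv_lhs => rw [← b.linearCombination_repr c, Finsupp.linearCombination_apply]
          rfl
        conv_lhs => rw [h1, Finset.mul_sum, map_sum, Finsupp.finsetSum_apply]
        rw [Finset.sum_eq_single_of_mem v hv]
        · rw [mul_smul_comm, hb, shapeBasis_apply, ← hb,
            show (v.2 : ℕ) = p v.1 - 1 by
              have := hcoord v (Finsupp.mem_support_iff.1 hv)
              omega, (X_one_pow_mul_last (K := K) h hm hmt n v.1 v.1.2).1 w hw (by omega)]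
          have h2 := shapeBasis_apply (K := K) h hm hmt ht' v₀
          rw [← hb] at h2
          change b v₀ = x ^ (p w - 1) * Ideal.Quotient.mk (shapeIdeal K t p m)
            (stringGen K t p w) at h2
          rw [← hx, ← h2, map_smul, b.repr_self, Finsupp.smul_single, Finsupp.single_eq_same,
            smul_eq_mul, mul_one]
        · intro u hu huv
          have h2 := hcoord u (Finsupp.mem_support_iff.1 hu)
          have h3 := hcoord v (Finsupp.mem_support_iff.1 hv)
          have h4 : (u.1 : ℕ) + p u.1 ≠ v.1 + p v.1 := by
            intro e
            apply huv
            have h5 := h.inj u.1 u.1.2 v.1 v.1.2 e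
            rcases u with ⟨i, s⟩
            rcases v with ⟨i', s'⟩
            obtain rfl : i = i' := Fin.ext h5
            congr 1
            apply Fin.ext
            dsimp only at h2 h3
            omega
          have h5 := hmin u hu
          rw [mul_smul_comm, hb, shapeBasis_apply, ← hb, show (u.2 : ℕ) = p u.1 - 1 by omega,
            (X_one_pow_mul_last (K := K) h hm hmt n u.1 u.1.2).2 (by omega), smul_zero, map_zero,
            Finsupp.zero_apply]
      refine Finsupp.mem_support_iff.1 hv ?_
      rw [← hval]
      have h1 : Ideal.Quotient.mk (shapeIdeal K t p m) (X 1) ^ n * c =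
          Ideal.Quotient.mk (shapeIdeal K t p m) (r * (X 0 ^ (Nat.find hex - 1) * X 1 ^ n)) := by
        rw [hc]
        generalize Nat.find hex - 1 = N
        rw [hx, ha, ← map_pow, ← map_pow, ← map_mul, ← map_mul]
        congr 1
        ring
      rw [h1]
      exact hr (X 0 ^ (Nat.find hex - 1) * X 1 ^ n)
  · intro n r hr hn
    have h1 : Ideal.Quotient.mk (shapeIdeal K t p m) r ∈ gradedPiece (shapeIdeal K t p m) n :=
      mk_mem_gradedPiece hr
    rw [gradedPiece_shapeIdeal h hm hmt ht', ← hb, b.mem_span_image] at h1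
    change b.coord v₀ (Ideal.Quotient.mk (shapeIdeal K t p m) r) = 0
    rw [b.coord_apply]
    by_contra hne
    have h2 := h1 (Finsupp.mem_support_iff.2 hne)
    rw [Set.mem_ofPred_eq] at h2
    change w + (p w - 1) = n at h2
    omega

end RealizationBasis

/-! ### The Jordan types are exactly the partitions of the given shape -/

section Realizes

variable (K : Type*) [Field K]

/-- Every partition of the right shape is a complete intersection Jordan type. -/
theorem exists_realizes {d k t t' n : ℕ} (hd : 1 ≤ d) (hk : 1 ≤ k)
    (ht : t = d ∧ t' = d + k - 1 ∨ t = d + k - 1 ∧ t' = d) {P : n.Partition}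
    (h : IsShape t t' P.parts) : ∃ I : Ideal (MvPolynomial (Fin 2) K),
      Realizes d k P I (X 0) ∧ ∃ ψ : MvPolynomial (Fin 2) K →ₗ[K] K,
      (∀ r, r ∈ I ↔ ∀ s, ψ (r * s) = 0) ∧
      ∀ (i : ℕ) (r : MvPolynomial (Fin 2) K), r.IsHomogeneous i → i ≠ 2 * d + k - 3 →
        ψ r = 0 := by
  have hT := (isShape_parts_iff hd hk ht P).1 h
  obtain ⟨rfl, hs⟩ := h
  obtain ⟨m, hm, hmt⟩ := hs.exists_index le_rfl (by omega)
  have ht' : 0 < t' := by omega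
  obtain ⟨ψ, h1, h2⟩ := exists_functional (K := K) hs hm hmt ht'
  refine ⟨shapeIdeal K P.parts.card (rows P.parts) m, ⟨isGradedCI_shapeIdeal hs hm hmt ht', ?_,
    isHomogeneous_X _ _, ?_⟩, ψ, h1, ?_⟩
  · intro i
    rw [hilbertFunction_shapeIdeal hs hm hmt ht', ← hT.1]
    rfl
  · exact ⟨shapeBasis hs hm hmt ht', isStringBasis_shapeBasis hs hm hmt ht'⟩
  · intro i r hr hi
    exact h2 i r hr (by omega)

theorem cijtWithParts_eq {d k t t' : ℕ} (hd : 1 ≤ d) (hk : 1 ≤ k)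
    (ht : t = d ∧ t' = d + k - 1 ∨ t = d + k - 1 ∧ t' = d) :
    cijtWithParts K d k t = {P | IsShape t t' P.parts} := by
  ext P
  rw [Set.mem_ofPred_eq, isShape_parts_iff hd hk ht]
  constructor
  · rintro ⟨h1, h2⟩
    exact ⟨h1.1, h2⟩
  · rintro ⟨h1, h2⟩
    obtain ⟨I, h3, -⟩ := exists_realizes K hd hk ht ((isShape_parts_iff hd hk ht P).2 ⟨h1, h2⟩)
    exact ⟨⟨h1, I, _, h3⟩, h2⟩

end Realizes

/-! ### Macaulay duality and the Hessian criterion -/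

section Duality

variable {K : Type*} [Field K]

/-- The exponent of the monomial `x ^ (i - u) * y ^ u`. -/
noncomputable def formExponent (i u : ℕ) : Fin 2 →₀ ℕ :=
  Finsupp.single 0 (i - u) + Finsupp.single 1 u

theorem formExponent_zero (i u : ℕ) : formExponent i u 0 = i - u := by
  simp [formExponent]

theorem formExponent_one (i u : ℕ) : formExponent i u 1 = u := by
  simp [formExponent]

theorem eq_formExponent {m : Fin 2 →₀ ℕ} {i : ℕ} (h : m.degree = i) : m = formExponent i (m 1) := by
  rw [degree_fin_two] at h
  ext s
  fin_cases s
  · change m 0 = formExponent i (m 1) 0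
    rw [formExponent_zero]
    omega
  · exact (formExponent_one i (m 1)).symm

theorem formExponent_injective {i u u' : ℕ} (h : formExponent i u = formExponent i u') :
    u = u' := by
  rw [← formExponent_one i u, h, formExponent_one]

theorem degree_formExponent {i u : ℕ} (h : u ≤ i) : (formExponent i u).degree = i := by
  rw [degree_fin_two, formExponent_zero, formExponent_one]
  omega

theorem monomialBasis_eq (i : ℕ) (u : Fin (i + 1)) :
    monomialBasis K i u = monomial (formExponent i u) 1 := by
  rw [monomialBasis, X_pow_eq_monomial, X_pow_eq_monomial, monomial_mul, one_mul]
  rfl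

theorem isHomogeneous_monomialBasis (i : ℕ) (u : Fin (i + 1)) :
    (monomialBasis K i u).IsHomogeneous i := by
  rw [monomialBasis_eq]
  exact isHomogeneous_monomial _ (degree_formExponent (by omega))

theorem coeff_sum_monomialBasis (i : ℕ) (c : Fin (i + 1) → K) (v : Fin (i + 1)) :
    coeff (formExponent i v) (∑ u, c u • monomialBasis K i u) = c v := by
  classical
  rw [coeff_sum, Finset.sum_eq_single v]
  · rw [coeff_smul, monomialBasis_eq, coeff_monomial, if_pos rfl, smul_eq_mul, mul_one]
  · intro u _ hu
    rw [coeff_smul, monomialBasis_eq, coeff_monomial, if_neg, smul_zero]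
    exact fun e => hu (Fin.ext (formExponent_injective e))
  · intro h
    exact absurd (Finset.mem_univ _) h

theorem isHomogeneous_sum_monomialBasis (i : ℕ) (c : Fin (i + 1) → K) :
    (∑ u, c u • monomialBasis K i u).IsHomogeneous i :=
  Submodule.sum_mem (homogeneousSubmodule (Fin 2) K i) fun u _ =>
    Submodule.smul_mem _ _ (isHomogeneous_monomialBasis i u)

theorem eq_sum_monomialBasis {i : ℕ} {r : MvPolynomial (Fin 2) K} (hr : r.IsHomogeneous i) :
    r = ∑ u : Fin (i + 1), coeff (formExponent i u) r • monomialBasis K i u := by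
  ext m
  by_cases hm : m.degree = i
  · have h1 := eq_formExponent hm
    have h2 : m 1 < i + 1 := by
      rw [degree_fin_two] at hm
      omega
    rw [h1]
    exact (coeff_sum_monomialBasis i (fun u : Fin (i + 1) => coeff (formExponent i u) r)
      ⟨m 1, h2⟩).symm
  · rw [hr.coeff_eq_zero hm, (isHomogeneous_sum_monomialBasis i _).coeff_eq_zero hm]

/-- The product of the factorials of the exponents of a monomial. -/
def expFactorial (m : Fin 2 →₀ ℕ) : ℕ := (m 0).factorial * (m 1).factorial

theorem expFactorial_add_single (m : Fin 2 →₀ ℕ) (s : Fin 2) :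
    expFactorial (m + Finsupp.single s 1) = expFactorial m * (m s + 1) := by
  have hs : s = 0 ∨ s = 1 := by omega
  rcases hs with rfl | rfl <;> simp [expFactorial, Nat.factorial_succ] <;> ring

theorem expFactorial_ne_zero [CharZero K] (m : Fin 2 →₀ ℕ) : (expFactorial m : K) ≠ 0 :=
  Nat.cast_ne_zero.2 (mul_ne_zero (Nat.factorial_ne_zero _) (Nat.factorial_ne_zero _))

/-- The functional `r ↦ (r ∘ F)(0)` on `K[x,y]`. -/
noncomputable def dualFunctional (F : MvPolynomial (Fin 2) K) : MvPolynomial (Fin 2) K →ₗ[K] K :=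
  (basisMonomials (Fin 2) K).constr K fun m => (expFactorial m : K) * coeff m F

theorem dualFunctional_monomial (F : MvPolynomial (Fin 2) K) (m : Fin 2 →₀ ℕ) :
    dualFunctional F (monomial m 1) = expFactorial m * coeff m F := by
  have := (basisMonomials (Fin 2) K).constr_basis K
    (fun m => (expFactorial m : K) * coeff m F) m
  rwa [coe_basisMonomials] at this

theorem coeff_iterate_pderiv (s : Fin 2) (a : ℕ) (F : MvPolynomial (Fin 2) K) (n : Fin 2 →₀ ℕ) :
    (expFactorial n : K) * coeff n ((pderiv (R := K) s)^[a] F) =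
      expFactorial (n + Finsupp.single s a) * coeff (n + Finsupp.single s a) F := by
  induction a generalizing n with
  | zero => simp
  | succ a ih =>
    have h1 := ih (n + Finsupp.single s 1)
    rw [expFactorial_add_single, add_assoc, ← Finsupp.single_add, add_comm 1 a] at h1
    rw [Function.iterate_succ_apply', coeff_pderiv, ← h1]
    push_cast
    ring

/-- After normalization by factorials, differentiation becomes a shift of exponents. So the
functional of `F` records all coefficients of `r ∘ F`, and in characteristic zero it recovers the
annihilator. -/
theorem coeff_diffAct (r F : MvPolynomial (Fin 2) K) (n : Fin 2 →₀ ℕ) :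
    (expFactorial n : K) * coeff n (diffAct r F) = dualFunctional F (r * monomial n 1) := by
  conv_rhs => rw [r.as_sum, Finset.sum_mul, map_sum]
  rw [diffAct, coeff_sum, Finset.mul_sum]
  refine Finset.sum_congr rfl fun m _ => ?_
  have h1 : monomial m (coeff m r) * monomial n (1 : K) =
      coeff m r • monomial (n + m) (1 : K) := by
    rw [monomial_mul, smul_monomial, mul_one, smul_eq_mul, mul_one, add_comm]
  have h2 : n + m = n + Finsupp.single 0 (m 0) + Finsupp.single 1 (m 1) := by
    ext s
    fin_cases s <;> simp
  rw [h1, map_smul, dualFunctional_monomial, coeff_smul, smul_eq_mul, smul_eq_mul, mul_left_comm,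
    coeff_iterate_pderiv, coeff_iterate_pderiv, ← h2]

theorem linearMap_eq_zero {ψ : MvPolynomial (Fin 2) K →ₗ[K] K} {r : MvPolynomial (Fin 2) K}
    (h : ∀ n, ψ (r * monomial n 1) = 0) (s : MvPolynomial (Fin 2) K) : ψ (r * s) = 0 := by
  have : ψ ∘ₗ LinearMap.mulLeft K r = 0 := by
    refine (basisMonomials (Fin 2) K).ext fun n => ?_
    rw [coe_basisMonomials]
    exact h n
  exact LinearMap.congr_fun this s

theorem diffAct_eq_zero_iff [CharZero K] (r F : MvPolynomial (Fin 2) K) :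
    diffAct r F = 0 ↔ ∀ s, dualFunctional F (r * s) = 0 := by
  constructor
  · intro h
    refine linearMap_eq_zero fun n => ?_
    rw [← coeff_diffAct, h, coeff_zero, mul_zero]
  · intro h
    ext n
    have h1 := h (monomial n 1)
    rw [← coeff_diffAct] at h1
    exact (mul_eq_zero.1 h1).resolve_left (expFactorial_ne_zero n)

theorem dualFunctional_eq_zero {F r : MvPolynomial (Fin 2) K} {i j : ℕ} (hF : F.IsHomogeneous j)
    (hr : r.IsHomogeneous i) (hij : i ≠ j) : dualFunctional F r = 0 := by
  rw [eq_sum_monomialBasis hr, map_sum]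
  refine Finset.sum_eq_zero fun u _ => ?_
  rw [map_smul, monomialBasis_eq, dualFunctional_monomial, hF.coeff_eq_zero, mul_zero, smul_zero]
  rwa [degree_formExponent (by omega)]

/-- The coefficients of `F` are the values of `ψ` on monomials of degree `j`, divided by factorials.
The functional of `F` is then `ψ` itself. -/
theorem exists_isDualGenerator [CharZero K] {I : Ideal (MvPolynomial (Fin 2) K)} {j : ℕ}
    {ψ : MvPolynomial (Fin 2) K →ₗ[K] K} (hI : ∀ r, r ∈ I ↔ ∀ s, ψ (r * s) = 0)
    (hψ : ∀ (i : ℕ) (r : MvPolynomial (Fin 2) K), r.IsHomogeneous i → i ≠ j → ψ r = 0) :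
    ∃ F, IsDualGenerator I j F := by
  set F : MvPolynomial (Fin 2) K := ∑ u : Fin (j + 1),
    (ψ (monomialBasis K j u) / (expFactorial (formExponent j u) : K)) • monomialBasis K j u with hF
  have hhom : F.IsHomogeneous j := isHomogeneous_sum_monomialBasis j _
  have h1 : dualFunctional F = ψ := by
    refine (basisMonomials (Fin 2) K).ext fun m => ?_
    rw [coe_basisMonomials]
    by_cases hm : m.degree = j
    · obtain ⟨u, hu⟩ : ∃ u : Fin (j + 1), m = formExponent j u := by
        refine ⟨⟨m 1, ?_⟩, eq_formExponent hm⟩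
        rw [degree_fin_two] at hm
        omega
      change dualFunctional F (monomial m 1) = ψ (monomial m 1)
      rw [hu, dualFunctional_monomial, hF, coeff_sum_monomialBasis, monomialBasis_eq,
        mul_div_cancel₀ _ (expFactorial_ne_zero _)]
    · have h2 : (monomial m (1 : K)).IsHomogeneous m.degree := isHomogeneous_monomial _ rfl
      exact (dualFunctional_eq_zero hhom h2 hm).trans (hψ _ _ h2 hm).symm
  exact ⟨F, hhom, fun r => by rw [hI, diffAct_eq_zero_iff, h1]⟩

/-- The value of a derivative of `F` at the point of a linear form. -/
theorem factorial_mul_eval_diffAct [CharZero K] {F α ℓ : MvPolynomial (Fin 2) K} {c e j : ℕ}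
    (hF : F.IsHomogeneous j) (hα : α.IsHomogeneous c) (hℓ : ℓ.IsHomogeneous 1) (hj : c + e = j) :
    (e.factorial : K) * eval (fun s => ℓ.coeff (Finsupp.single s 1)) (diffAct α F) =
      dualFunctional F (α * ℓ ^ e) := by
  have hG : (diffAct α F).IsHomogeneous e := by
    intro n hn
    by_contra hne
    apply hn
    have h1 : (monomial n (1 : K)).IsHomogeneous n.degree := isHomogeneous_monomial _ rfl
    have h2 := coeff_diffAct α F n
    rw [dualFunctional_eq_zero hF (hα.mul h1)] at h2
    · exact (mul_eq_zero.1 h2).resolve_left (expFactorial_ne_zero n)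
    · intro h3
      apply hne
      have h4 : n.degree = Finsupp.weight 1 n := congrArg (fun f => f n) Finsupp.degree_eq_weight_one
      omega
  set p : Fin 2 → K := fun s => ℓ.coeff (Finsupp.single s 1) with hp
  -- In the binomial expansion, each coefficient times the factorials of its exponents equals `e!`,
  -- the factor in the statement.
  have hpow : ℓ ^ e = ∑ u : Fin (e + 1),
      (p 0 ^ (e - u) * p 1 ^ (u : ℕ) * (e.choose u : K)) • monomialBasis K e u := by
    have h1 := eq_of_isHomogeneous_one hℓ
    have h2 : ℓ = C (p 1) * X 1 + C (p 0) * X 0 := by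
      rw [C_mul', C_mul', add_comm]
      exact h1
    rw [h2, add_pow, Finset.sum_range]
    refine Finset.sum_congr rfl fun u _ => ?_
    rw [monomialBasis, smul_eq_C_mul, C_mul, C_mul, C_pow, C_pow, mul_pow, mul_pow,
      map_natCast]
    ring
  conv_lhs => rw [eq_sum_monomialBasis hG, map_sum, Finset.mul_sum]
  rw [hpow, Finset.mul_sum, map_sum]
  refine Finset.sum_congr rfl fun u _ => ?_
  have h1 : dualFunctional F (α * monomialBasis K e u) =
      expFactorial (formExponent e u) * coeff (formExponent e u) (diffAct α F) := by
    rw [monomialBasis_eq, ← coeff_diffAct]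
  have h2 : eval p (monomialBasis K e u) = p 0 ^ (e - u) * p 1 ^ (u : ℕ) := by
    rw [monomialBasis, map_mul, map_pow, map_pow, eval_X, eval_X]
  rw [mul_smul_comm _ α, map_smul (dualFunctional F), h1, smul_eval, h2, smul_eq_mul,
    expFactorial, formExponent_zero, formExponent_one,
    ← Nat.choose_mul_factorial_mul_factorial (by omega : (u : ℕ) ≤ e)]
  push_cast
  ring

/-- The matrix at `ℓ`, times `e!`, is the Gram matrix of `(r, s) ↦ ψ (ℓ ^ e * r * s)` on forms of
degree `i`, with `ψ` the functional of `F`. A vector in its kernel is a form `r` for which `ψ (ℓ ^ e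
* r * s)` vanishes on all `s` of degree `i`. For `s` of other degrees it vanishes anyway, so `ℓ ^ e
* r` lies in the annihilator. -/
theorem hessianAt_eq_zero_iff [CharZero K] {I : Ideal (MvPolynomial (Fin 2) K)}
    {F ℓ : MvPolynomial (Fin 2) K} {i e j : ℕ} (hF : IsDualGenerator I j F)
    (hℓ : ℓ.IsHomogeneous 1) (hj : 2 * i + e = j) :
    hessianAt i F ℓ = 0 ↔
      ∃ r : MvPolynomial (Fin 2) K, r.IsHomogeneous i ∧ r ≠ 0 ∧ ℓ ^ e * r ∈ I := by
  obtain ⟨hFj, hI⟩ := hF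
  simp only [diffAct_eq_zero_iff] at hI
  have he : (e.factorial : K) ≠ 0 := Nat.cast_ne_zero.2 (Nat.factorial_ne_zero e)
  rw [hessianAt, RingHom.map_det, ← Matrix.exists_mulVec_eq_zero_iff]
  set N := (eval fun s => ℓ.coeff (Finsupp.single s 1)).mapMatrix (hessianMatrix i F) with hN
  have hentry : ∀ (c : Fin (i + 1) → K) u, (e.factorial : K) * (N.mulVec c) u =
      dualFunctional F (ℓ ^ e * (∑ v, c v • monomialBasis K i v) * monomialBasis K i u) := by
    intro c u
    rw [Matrix.mulVec, dotProduct, Finset.mul_sum, Finset.mul_sum, Finset.sum_mul, map_sum]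
    refine Finset.sum_congr rfl fun v _ => ?_
    have h1 := factorial_mul_eval_diffAct hFj
      ((isHomogeneous_monomialBasis (K := K) i u).mul (isHomogeneous_monomialBasis i v)) hℓ
      (by omega : i + i + e = j)
    rw [mul_smul_comm, smul_mul_assoc, map_smul,
      show ℓ ^ e * monomialBasis K i v * monomialBasis K i u =
        monomialBasis K i u * monomialBasis K i v * ℓ ^ e by ring, ← h1, smul_eq_mul]
    simp only [hN, hessianMatrix, RingHom.mapMatrix_apply, Matrix.map_apply, Matrix.of_apply]
    ring
  constructor
  · rintro ⟨c, hc, h0⟩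
    refine ⟨∑ v, c v • monomialBasis K i v, isHomogeneous_sum_monomialBasis i c, ?_, ?_⟩
    · intro hz
      apply hc
      funext v
      rw [← coeff_sum_monomialBasis i c v, hz, coeff_zero, Pi.zero_apply]
    · rw [hI]
      refine linearMap_eq_zero fun n => ?_
      by_cases hn : n.degree = i
      · have hn1 : n 1 < i + 1 := by
          rw [degree_fin_two] at hn
          omega
        have h1 : monomial n (1 : K) = monomialBasis K i ⟨n 1, hn1⟩ := by
          rw [monomialBasis_eq, ← eq_formExponent hn]
        rw [h1, ← hentry, h0, Pi.zero_apply, mul_zero]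
      · have h1 : (monomial n (1 : K)).IsHomogeneous n.degree := isHomogeneous_monomial _ rfl
        refine dualFunctional_eq_zero hFj
          (((hℓ.pow e).mul (isHomogeneous_sum_monomialBasis i c)).mul h1) ?_
        omega
  · rintro ⟨r, hr, hne, hmem⟩
    refine ⟨fun u => coeff (formExponent i u) r, ?_, ?_⟩
    · intro h0
      apply hne
      rw [eq_sum_monomialBasis hr]
      refine Finset.sum_eq_zero fun u _ => ?_
      rw [show coeff (formExponent i u) r = 0 from congrFun h0 u, zero_smul]
    · funext u
      have h1 := hentry (fun u => coeff (formExponent i u) r) u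
      rw [← eq_sum_monomialBasis hr, (hI _).1 hmem] at h1
      exact (mul_eq_zero.1 h1).resolve_left he

/-- There are `i + 1` monomials of degree `i`, so a component of that dimension leaves no room for a
relation. For `i < d` this identifies nonzero forms with nonzero classes in the Hessian criterion.
-/
theorem eq_zero_of_mem_of_hilbertFunction {I : Ideal (MvPolynomial (Fin 2) K)} {i : ℕ}
    (hH : hilbertFunction I i = i + 1) {r : MvPolynomial (Fin 2) K} (hr : r.IsHomogeneous i)
    (hrI : r ∈ I) : r = 0 := by
  have h1 : Submodule.span K (Set.range fun u : Fin (i + 1) =>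
      Ideal.Quotient.mk I (monomialBasis K i u)) = gradedPiece I i := by
    apply le_antisymm
    · rw [Submodule.span_le]
      rintro _ ⟨u, rfl⟩
      exact mk_mem_gradedPiece (isHomogeneous_monomialBasis i u)
    · intro a ha
      obtain ⟨s, hs, rfl⟩ := mem_gradedPiece.1 ha
      rw [eq_sum_monomialBasis hs, map_sum]
      refine Submodule.sum_mem _ fun u _ => ?_
      rw [mk_smul]
      exact Submodule.smul_mem _ _ (Submodule.subset_span ⟨u, rfl⟩)
  have h2 : LinearIndependent K fun u : Fin (i + 1) =>
      Ideal.Quotient.mk I (monomialBasis K i u) := by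
    rw [linearIndependent_iff_card_eq_finrank_span, Set.finrank, h1, Fintype.card_fin]
    exact hH.symm
  have h3 : ∑ u : Fin (i + 1), coeff (formExponent i u) r •
      Ideal.Quotient.mk I (monomialBasis K i u) = 0 := by
    rw [← Ideal.Quotient.eq_zero_iff_mem, eq_sum_monomialBasis hr, map_sum] at hrI
    simpa only [mk_smul] using hrI
  have h4 := Fintype.linearIndependent_iff.1 h2 _ h3
  rw [eq_sum_monomialBasis hr]
  exact Finset.sum_eq_zero fun u _ => by rw [h4, zero_smul]

theorem vanishingHessians_eq [CharZero K] {d k t t' : ℕ} (hd : 1 ≤ d) (hk : 1 ≤ k)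
    (ht : t = d ∧ t' = d + k - 1 ∨ t = d + k - 1 ∧ t' = d) {P : (d * (d + k - 1)).Partition}
    (hP : IsShape t t' P.parts) {I : Ideal (MvPolynomial (Fin 2) K)}
    {F ℓ : MvPolynomial (Fin 2) K} (h : Realizes d k P I ℓ)
    (hF : IsDualGenerator I (2 * d + k - 3) F) :
    vanishingHessians d F ℓ = shortDegrees d (2 * d + k - 3) (rows P.parts) := by
  have hcard := hP.1
  obtain ⟨y, hy, hx, hh⟩ := h.exists_planeGrading hd hk (by omega)
  ext i
  rw [vanishingHessians, shortDegrees, Set.mem_ofPred_eq, Set.mem_ofPred_eq]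
  refine and_congr_right fun hi => ?_
  rw [hessianAt_eq_zero_iff hF h.2.2.1 (by omega : 2 * i + (2 * d + k - 3 - 2 * i) = 2 * d + k - 3)]
  have h1 := hy.exists_pow_mul_eq_zero_iff hx (i := i) (e := 2 * d + k - 3 - 2 * i) (by
    intro u hu
    rw [hh]
    have := hP.2.lb u (by omega)
    omega)
  rw [hh, show 2 * d + k - 3 - 2 * i + i = 2 * d + k - 3 - i by omega] at h1
  rw [← h1]
  have hH : hilbertFunction I i = i + 1 := by
    rw [h.2.1, T]
    omega
  constructor
  · rintro ⟨r, hr, hne, hmem⟩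
    refine ⟨Ideal.Quotient.mk I r, mk_mem_gradedPiece hr, ?_, ?_⟩
    · intro h0
      exact hne (eq_zero_of_mem_of_hilbertFunction hH hr (Ideal.Quotient.eq_zero_iff_mem.1 h0))
    · rw [← map_pow, ← map_mul, Ideal.Quotient.eq_zero_iff_mem]
      exact hmem
  · rintro ⟨a, ha, hne, h0⟩
    obtain ⟨r, hr, rfl⟩ := mem_gradedPiece.1 ha
    refine ⟨r, hr, ?_, ?_⟩
    · rintro rfl
      exact hne (map_zero _)
    · rwa [← map_pow, ← map_mul, Ideal.Quotient.eq_zero_iff_mem] at h0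

theorem hessianSets_eq [CharZero K] {d k t t' : ℕ} (hd : 1 ≤ d) (hk : 1 ≤ k)
    (ht : t = d ∧ t' = d + k - 1 ∨ t = d + k - 1 ∧ t' = d) {P : (d * (d + k - 1)).Partition}
    (hP : IsShape t t' P.parts) :
    hessianSets K d k P = {shortDegrees d (2 * d + k - 3) (rows P.parts)} := by
  ext S
  rw [Set.mem_singleton_iff]
  constructor
  · rintro ⟨I, F, ℓ, h, hF, rfl⟩
    exact vanishingHessians_eq hd hk ht hP h hF
  · rintro rfl
    obtain ⟨I, h, ψ, h1, h2⟩ := exists_realizes K hd hk ht hP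
    obtain ⟨F, hF⟩ := exists_isDualGenerator h1 h2
    exact ⟨I, F, _, h, hF, vanishingHessians_eq hd hk ht hP h hF⟩

end Duality

end CIJT

theorem theorem3p15 (K : Type*) [Field K] [Infinite K] (d k : ℕ) (hd : 1 ≤ d) (hk : 1 ≤ k)
    (hchar : ringChar K = 0 ∨ 2 * d + k - 3 < ringChar K) :
    -- the block of smallest parts, and the bijection
    (∀ P ∈ CIJT.cijtWithParts K d k d, ∃ a : ℕ, a ≤ d - 1 ∧
      CIJT.smallestPart P = a + k ∧ P.parts.count (a + k) = a + 1) ∧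
    Set.BijOn CIJT.iota (CIJT.cijtWithParts K d k d) (CIJT.cijtWithParts K d k (d + k - 1)) ∧
    -- the vanishing Hessians depend on the partition only, and those of `ι(P)`
    (2 ≤ k → CharZero K → ∀ P ∈ CIJT.cijtWithParts K d k d, ∃ S : Set ℕ,
      d - 1 ∉ S ∧ CIJT.hessianSets K d k P = {S} ∧
        CIJT.hessianSets K d k (CIJT.iota P) = {S ∪ {d - 1}}) ∧
    -- the numbers of partitions
    (CIJT.cijtWithParts K d k d).ncard = 2 ^ (d - 1) ∧
    (CIJT.cijtWithParts K d k (d + k - 1)).ncard = 2 ^ (d - 1) ∧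
    -- the numbers of partitions with given smallest part
    (2 ≤ d →
      (∀ a : ℕ, a ≤ d - 2 →
        {P ∈ CIJT.cijtWithParts K d k d | CIJT.smallestPart P = a + k}.ncard
          = 2 ^ (d - 2 - a)) ∧
      ∃ P : (d * (d + k - 1)).Partition,
        {Q ∈ CIJT.cijtWithParts K d k d | CIJT.smallestPart Q = d + k - 1} = {P} ∧
          P.parts.count (d + k - 1) = d) ∧
    -- the degrees in which the strings begin
    (∀ P ∈ CIJT.cijtWithParts K d k d ∪ CIJT.cijtWithParts K d k (d + k - 1),
      ∀ (I : Ideal (MvPolynomial (Fin 2) K)) (ℓ : MvPolynomial (Fin 2) K),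
        CIJT.Realizes d k P I ℓ →
          Nonempty (CIJT.StringDecomposition I ℓ) ∧
          ∀ D : CIJT.StringDecomposition I ℓ,
            (∀ i s : ℕ, ¬ (i < P.parts.card ∧ s = CIJT.part P i) → D.V i s = ⊥) ∧
            ∀ i : ℕ, i < P.parts.card → Module.finrank K (D.V i (CIJT.part P i)) = 1) := by
  have e1 := CIJT.cijtWithParts_eq K hd hk (Or.inl ⟨rfl, rfl⟩)
  have e2 := CIJT.cijtWithParts_eq K hd hk (Or.inr ⟨rfl, rfl⟩)
  have hbij := CIJT.bijOn_iota (n := d * (d + k - 1)) (by omega : 0 < d)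
    (by omega : 0 < d + k - 1)
  refine ⟨?_, ?_, ?_, ?_, ?_, ?_, ?_⟩
  · intro P hP
    rw [e1] at hP
    obtain ⟨m, Q, hm, hm', hQ, h1, -, e, -⟩ := CIJT.IsShape.exists_parts hP (by omega)
    -- With `m` rows above the block, the parameter is `a = d - 1 - m`.
    have h2 : d + k - 1 - m = d - 1 - m + k := by omega
    refine ⟨d - 1 - m, by omega, ?_, ?_⟩
    · rw [CIJT.smallestPart_eq (by omega) h1 e, h2]
    · rw [← h2, e, CIJT.count_smallest h1]
      omega
  · rw [e1, e2]
    exact hbij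
  · intro hk2 _ P hP
    rw [e1] at hP
    obtain ⟨h1, h2⟩ := CIJT.shortDegrees_iota hd hk2 hP
    refine ⟨_, h1, CIJT.hessianSets_eq hd hk (Or.inl ⟨rfl, rfl⟩) hP, ?_⟩
    rw [CIJT.hessianSets_eq hd hk (Or.inr ⟨rfl, rfl⟩) (hbij.mapsTo hP), h2]
  · rw [e1, CIJT.ncard_isShape rfl (by omega), min_eq_left (by omega)]
  · rw [e2, CIJT.ncard_isShape (mul_comm _ _) (by omega), min_eq_right (by omega)]
  · intro hd2
    rw [e1]
    refine ⟨?_, ?_⟩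
    · intro a ha
      have h := CIJT.ncard_isShape_smallestPart (n := d * (d + k - 1)) (t := d)
        (t' := d + k - 1) (m := d - 1 - a) rfl (by omega) (by omega)
      rw [show d + k - 1 - (d - 1 - a) = a + k by omega,
        show d - 1 - a - 1 = d - 2 - a by omega] at h
      exact h
    · exact CIJT.exists_rectangle rfl (by omega) (by omega)
  · intro P hP I ℓ h
    have hc : P.parts.card = d ∨ P.parts.card = d + k - 1 := hP.imp (fun h => h.2) (fun h => h.2)
    exact ⟨h.nonempty_stringDecomposition hd hk hc, h.stringDecomposition_V hd hk hc⟩
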